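/- Let $k$ be a field, $n\ge 1$, and $S=k[x_1,\dots,x_n]$ with the standard grading. Order the monomials of $S$ lexicographically with $x_1>x_2>\dots>x_n$. For a squarefree monomial $a$ write $\operatorname{supp}(a)=\{i : x_i\mid a\}$, and let $\mathrm{Mon}^s_q(S)$ denote the set of squarefree monomials of degree $q$ in $S$. For $u,v\in \mathrm{Mon}^s_q(S)$ put $$L(u,v)=\{a\in \mathrm{Mon}^s_q(S) : u\ge_{lex} a\ge_{lex} v\},\quad L^i(v)=\{a\in \mathrm{Mon}^s_q(S) : a\ge_{lex} v\},\quad L^f(u)=\{a\in \mathrm{Mon}^s_q(S) : u\ge_{lex} a\}.$$ A homogeneous ideal $I\subset S$ has an $e$-linear resolution if it has a graded free resolution of the form $\cdots\to S(-e-2)^{b_2}\to S(-e-1)^{b_1}\to S(-e)^{b_0}\to I\to 0$ with all $b_i$ finite (such a resolution is automatically minimal), and $I$ is generated in degree $e$ if it is generated by homogeneous polynomials of degree $e$. Let $w,m\in \mathrm{Mon}^s_d(S)$ with $x_1\mid w$ and $x_1\nmid m$, and let $J=(L^i(w))$ and $K=(L^f(m))$ be the ideals of $S$ generated by $L^i(w)$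 and $L^f(m)$. Then: 1. $J+K$ has a $d$-linear resolution if and only if $J\cap K$ has a $(d+1)$-linear resolution. 2. The set $[n]\setminus\operatorname{supp}(w)$ is nonempty, where $[n]=\{1,\dots,n\}$, and $J\cap K$ is generated in degree $d+1$ if and only if $$J\cap K=\bigl(L(x_1m,\; w\,x_{\max([n]\setminus\operatorname{supp}(w))})\bigr).$$ -/

import Mathlib

/-!
Monomials of `S = k[x_1, …, x_n]` are represented by their exponent vectors in `Fin n →₀ ℕ`; the
variable `x_i` is `X (i - 1)`, so `x_1` has index `0`. The order on `Lex (Fin n →₀ ℕ)` is the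
lexicographic order with `x_1 > x_2 > ⋯ > x_n`.
-/

namespace SquarefreeLex

open MvPolynomial

/-- The set `Mon^s_d(S)` of squarefree monomials of degree `d` in `n` variables. -/
def sqfreeMon (n d : ℕ) : Set (Fin n →₀ ℕ) :=
  {a | (∀ i, a i ≤ 1) ∧ a.degree = d}

/-- The squarefree lexsegment set `L(u, v) = {a ∈ Mon^s_d(S) : u ≥ a ≥ v}` of degree `d`. -/
def lexSegment {n : ℕ} (d : ℕ) (u v : Fin n →₀ ℕ) : Set (Fin n →₀ ℕ) :=
  {a | a ∈ sqfreeMon n d ∧ toLex a ≤ toLex u ∧ toLex v ≤ toLex a}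

/-- The initial squarefree lexsegment set `L^i(v) = {a ∈ Mon^s_d(S) : a ≥ v}` of degree `d`. -/
def initialSegment {n : ℕ} (d : ℕ) (v : Fin n →₀ ℕ) : Set (Fin n →₀ ℕ) :=
  {a | a ∈ sqfreeMon n d ∧ toLex v ≤ toLex a}

/-- The final squarefree lexsegment set `L^f(u) = {a ∈ Mon^s_d(S) : u ≥ a}` of degree `d`. -/
def finalSegment {n : ℕ} (d : ℕ) (u : Fin n →₀ ℕ) : Set (Fin n →₀ ℕ) :=
  {a | a ∈ sqfreeMon n d ∧ toLex a ≤ toLex u}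

/-- The ideal of `k[x_1, …, x_n]` generated by a set of monomials. -/
noncomputable def monomialIdeal (k : Type*) [Field k] {n : ℕ} (A : Set (Fin n →₀ ℕ)) :
    Ideal (MvPolynomial (Fin n) k) :=
  Ideal.span ((fun a => monomial a (1 : k)) '' A)

/-- The ideal `I` is generated by homogeneous polynomials of degree `e`. -/
def GeneratedInDegree {k : Type*} [Field k] {n : ℕ} (I : Ideal (MvPolynomial (Fin n) k))
    (e : ℕ) : Prop :=
  ∃ G : Set (MvPolynomial (Fin n) k), (∀ f ∈ G, f.IsHomogeneous e) ∧ Ideal.span G = I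

/-- `I` has an `e`-linear resolution: there is an exact sequence of graded `S`-modules with maps of
degree `0`
`⋯ → S(-e-2)^{b 2} → S(-e-1)^{b 1} → S(-e)^{b 0} → I → 0`.
A map `ε : S^{b 0} → S` has degree `0` with respect to these shifts if and only if it sends the
standard basis to homogeneous polynomials of degree `e`, and `δ i : S^{b (i+1)} → S^{b i}` does if
and only if the entries of its matrix are linear forms (possibly zero). Since these entries have no
constant term, such a resolution is automatically the minimal graded free resolution of `I`. -/
def HasLinearResolution {k : Type*} [Field k] {n : ℕ} (I : Ideal (MvPolynomial (Fin n) k))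
    (e : ℕ) : Prop :=
  ∃ (b : ℕ → ℕ)
    (ε : (Fin (b 0) → MvPolynomial (Fin n) k) →ₗ[MvPolynomial (Fin n) k] MvPolynomial (Fin n) k)
    (δ : ∀ i : ℕ, (Fin (b (i + 1)) → MvPolynomial (Fin n) k) →ₗ[MvPolynomial (Fin n) k]
      (Fin (b i) → MvPolynomial (Fin n) k)),
    (∀ c, (ε (Pi.single c 1)).IsHomogeneous e) ∧
    (∀ i c r, (δ i (Pi.single c 1) r).IsHomogeneous 1) ∧
    LinearMap.range ε = I ∧
    Function.Exact (δ 0) ε ∧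
    ∀ i, Function.Exact (δ (i + 1)) (δ i)

end SquarefreeLex

/-! The first equivalence rests on `0 → J ∩ K → J ⊕ K → J + K → 0`. Both `J` and `K` have `d`-linear
resolutions, because initial and final squarefree segments have linear quotients when their
generators are listed in decreasing, respectively increasing, lex order
(`hasLinearResolution_of_linearQuotients`).

If `J ∩ K` has a `(d+1)`-linear resolution, the mapping cone of a lift of `p ↦ (p, -p)` is a
`d`-linear resolution of `J + K` (`hasLinearResolution_add`). The same cone also proves the linear
quotients criterion, one generator at a time.

Conversely, lift `J ⊕ K → J + K` to a chain map of linear resolutions. Every monomial of `J` of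
degree `d` is divisible by `x_1` and none of `K` is, so `J ∩ K` vanishes in degree `d`. This makes
the lift bijective in homological degree `0`; minimality then makes it a split injection in every
homological degree. Its cokernel, shifted by one, resolves `J ∩ K` (`hasLinearResolution_inf`).

The second equivalence is a computation in degree `d + 1`: the monomials of `J ∩ K` in that degree
are exactly those of the stated segment (`mem_lexSegment_of_le`, `exists_le_of_mem_lexSegment`). -/

namespace SquarefreeLex

open MvPolynomial

/-! ### Graded maps of free modules, and lifting them -/

section HomogeneousMaps

variable {k : Type*} [Field k] {n : ℕ} {ι κ μ : Type*}

/-- The linear form `f` on a free module over `k[x_1, …, x_n]` raises degrees by `e`. -/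
def IsHomogeneousForm (f : (ι → MvPolynomial (Fin n) k) →ₗ[MvPolynomial (Fin n) k]
    MvPolynomial (Fin n) k) (e : ℕ) : Prop :=
  ∀ a v, (∀ c, (v c).IsHomogeneous a) → (f v).IsHomogeneous (a + e)

/-- The linear map `f` between free modules over `k[x_1, …, x_n]` raises degrees by `e`. -/
def IsHomogeneousMap (f : (ι → MvPolynomial (Fin n) k) →ₗ[MvPolynomial (Fin n) k]
    (κ → MvPolynomial (Fin n) k)) (e : ℕ) : Prop :=
  ∀ a v, (∀ c, (v c).IsHomogeneous a) → ∀ r, (f v r).IsHomogeneous (a + e)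

theorem isHomogeneous_piSingle_one [DecidableEq ι] (c c' : ι) :
    ((Pi.single c 1 : ι → MvPolynomial (Fin n) k) c').IsHomogeneous 0 := by
  by_cases h : c' = c
  · subst h; simpa using isHomogeneous_one _ _
  · simpa [h] using isHomogeneous_zero _ _ _

theorem isHomogeneousForm_iff [Fintype ι] [DecidableEq ι]
    {f : (ι → MvPolynomial (Fin n) k) →ₗ[MvPolynomial (Fin n) k] MvPolynomial (Fin n) k} {e : ℕ} :
    IsHomogeneousForm f e ↔ ∀ c, (f (Pi.single c 1)).IsHomogeneous e := by
  refine ⟨fun h c => by simpa using h 0 _ (isHomogeneous_piSingle_one c), fun h a v hv => ?_⟩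
  rw [LinearMap.pi_apply_eq_sum_univ f v]
  refine IsHomogeneous.sum _ _ _ fun c _ => (hv c).mul ?_
  convert h c using 2
  funext j
  simp [Pi.single_apply, eq_comm]

theorem isHomogeneousMap_iff_form
    {f : (ι → MvPolynomial (Fin n) k) →ₗ[MvPolynomial (Fin n) k] (κ → MvPolynomial (Fin n) k)}
    {e : ℕ} : IsHomogeneousMap f e ↔ ∀ r, IsHomogeneousForm (LinearMap.proj r ∘ₗ f) e :=
  ⟨fun h r a v hv => h a v hv r, fun h a v hv r => h r a v hv⟩

theorem isHomogeneousMap_iff [Fintype ι] [DecidableEq ι]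
    {f : (ι → MvPolynomial (Fin n) k) →ₗ[MvPolynomial (Fin n) k] (κ → MvPolynomial (Fin n) k)}
    {e : ℕ} : IsHomogeneousMap f e ↔ ∀ c r, (f (Pi.single c 1) r).IsHomogeneous e := by
  simp only [isHomogeneousMap_iff_form, isHomogeneousForm_iff]
  exact forall_comm

theorem IsHomogeneousMap.comp
    {g : (κ → MvPolynomial (Fin n) k) →ₗ[MvPolynomial (Fin n) k] (μ → MvPolynomial (Fin n) k)}
    {f : (ι → MvPolynomial (Fin n) k) →ₗ[MvPolynomial (Fin n) k] (κ → MvPolynomial (Fin n) k)}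
    {a b : ℕ} (hg : IsHomogeneousMap g b) (hf : IsHomogeneousMap f a) :
    IsHomogeneousMap (g ∘ₗ f) (a + b) := fun d v hv r => by
  simpa [add_assoc] using hg _ _ (hf d v hv) r

theorem IsHomogeneousForm.comp
    {g : (κ → MvPolynomial (Fin n) k) →ₗ[MvPolynomial (Fin n) k] MvPolynomial (Fin n) k}
    {f : (ι → MvPolynomial (Fin n) k) →ₗ[MvPolynomial (Fin n) k] (κ → MvPolynomial (Fin n) k)}
    {a b : ℕ} (hg : IsHomogeneousForm g b) (hf : IsHomogeneousMap f a) :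
    IsHomogeneousForm (g ∘ₗ f) (a + b) := fun d v hv => by
  simpa [add_assoc] using hg _ _ (hf d v hv)

theorem IsHomogeneousForm.add
    {f g : (ι → MvPolynomial (Fin n) k) →ₗ[MvPolynomial (Fin n) k] MvPolynomial (Fin n) k}
    {e : ℕ} (hf : IsHomogeneousForm f e) (hg : IsHomogeneousForm g e) :
    IsHomogeneousForm (f + g) e := fun d v hv => (hf d v hv).add (hg d v hv)

theorem IsHomogeneousForm.neg
    {f : (ι → MvPolynomial (Fin n) k) →ₗ[MvPolynomial (Fin n) k] MvPolynomial (Fin n) k}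
    {e : ℕ} (hf : IsHomogeneousForm f e) : IsHomogeneousForm (-f) e :=
  fun d v hv => (hf d v hv).neg

theorem IsHomogeneousMap.sub
    {f g : (ι → MvPolynomial (Fin n) k) →ₗ[MvPolynomial (Fin n) k] (κ → MvPolynomial (Fin n) k)}
    {e : ℕ} (hf : IsHomogeneousMap f e) (hg : IsHomogeneousMap g e) :
    IsHomogeneousMap (f - g) e := fun d v hv r => (hf d v hv r).sub (hg d v hv r)

theorem isHomogeneousMap_id :
    IsHomogeneousMap (LinearMap.id : (ι → MvPolynomial (Fin n) k) →ₗ[MvPolynomial (Fin n) k] _) 0 :=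
  fun _ _ hv => hv

/-- The homogeneous component of degree `a` of a vector of polynomials. -/
noncomputable def vecComponent (a : ℕ) (v : ι → MvPolynomial (Fin n) k) :
    ι → MvPolynomial (Fin n) k := fun c => homogeneousComponent a (v c)

/-- Decompose `v` into finitely many components. The form sends the one of degree `b` into degree `b
+ e`, so only `b = a` contributes in degree `a + e`. -/
theorem IsHomogeneousForm.apply_vecComponent [Finite ι]
    {f : (ι → MvPolynomial (Fin n) k) →ₗ[MvPolynomial (Fin n) k] MvPolynomial (Fin n) k} {e : ℕ}
    (hf : IsHomogeneousForm f e) (a : ℕ) (v : ι → MvPolynomial (Fin n) k) :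
    f (vecComponent a v) = homogeneousComponent (a + e) (f v) := by
  classical
  cases nonempty_fintype ι
  obtain ⟨N, hN⟩ : ∃ N, ∀ c, (v c).totalDegree < N :=
    ⟨∑ c, (v c).totalDegree + 1, fun c => Nat.lt_succ_of_le
      (Finset.single_le_sum (f := fun c => (v c).totalDegree) (fun _ _ => Nat.zero_le _)
        (Finset.mem_univ c))⟩
  have hz : ∀ b, N ≤ b → vecComponent b v = 0 := fun b hb => funext fun c =>
    homogeneousComponent_eq_zero _ _ ((hN c).trans_le hb)
  have hv : v = ∑ b ∈ Finset.range N, vecComponent b v := by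
    funext c
    rw [Finset.sum_apply]
    conv_lhs => rw [← sum_homogeneousComponent (v c)]
    refine Finset.sum_subset (Finset.range_mono (hN c)) fun b _ hb => ?_
    exact homogeneousComponent_eq_zero _ _ (by simpa using hb)
  have hcomp : ∀ b, homogeneousComponent (a + e) (f (vecComponent b v)) =
      if b = a then f (vecComponent a v) else 0 := fun b => by
    rw [homogeneousComponent_of_mem
      (hf b (vecComponent b v) fun c => homogeneousComponent_isHomogeneous _ _)]
    split_ifs with h1 h2 h2
    · rw [h2]
    · omega
    · omega
    · rfl
  conv_rhs => rw [hv, map_sum, map_sum, Finset.sum_congr rfl fun b _ => hcomp b]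
  rw [Finset.sum_ite_eq']
  split_ifs with h
  · rfl
  · rw [hz a (by simpa using h), map_zero]

/-- Lift each basis vector arbitrarily and keep only the component of degree `a`; this is still a
lift because the forms are graded. The index `μ` lets one statement cover a single form, a pair of
forms, and the coordinates of a map. -/
theorem exists_homogeneous_lift_forms [Finite ι] [Finite κ]
    {f : μ → (ι → MvPolynomial (Fin n) k) →ₗ[MvPolynomial (Fin n) k] MvPolynomial (Fin n) k}
    {g : μ → (κ → MvPolynomial (Fin n) k) →ₗ[MvPolynomial (Fin n) k] MvPolynomial (Fin n) k}
    {a e : ℕ} (hf : ∀ r, IsHomogeneousForm (f r) e) (hg : ∀ r, IsHomogeneousForm (g r) (a + e))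
    (hfg : ∀ x, ∃ y, ∀ r, f r y = g r x) :
    ∃ h : (κ → MvPolynomial (Fin n) k) →ₗ[MvPolynomial (Fin n) k] (ι → MvPolynomial (Fin n) k),
      IsHomogeneousMap h a ∧ ∀ r x, f r (h x) = g r x := by
  classical
  cases nonempty_fintype ι
  cases nonempty_fintype κ
  choose y hy using fun c : κ => hfg (Pi.single c 1)
  let b := Pi.basisFun (MvPolynomial (Fin n) k) κ
  let h := b.constr (MvPolynomial (Fin n) k) fun c => vecComponent a (y c)
  have hb : ∀ c, h (Pi.single c 1) = vecComponent a (y c) := fun c => by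
    rw [← Pi.basisFun_apply]; exact b.constr_basis _ _ c
  refine ⟨h, ?_, fun r => ?_⟩
  · rw [isHomogeneousMap_iff]
    intro c r
    rw [hb]
    exact homogeneousComponent_isHomogeneous _ _
  · suffices f r ∘ₗ h = g r from fun x => LinearMap.congr_fun this x
    refine b.ext fun c => ?_
    rw [Pi.basisFun_apply, LinearMap.comp_apply, hb, (hf r).apply_vecComponent, hy]
    exact homogeneousComponent_eq_self (isHomogeneousForm_iff.1 (hg r) c)

theorem exists_homogeneous_lift [Finite ι] [Finite κ]
    {f : (ι → MvPolynomial (Fin n) k) →ₗ[MvPolynomial (Fin n) k] (μ → MvPolynomial (Fin n) k)}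
    {g : (κ → MvPolynomial (Fin n) k) →ₗ[MvPolynomial (Fin n) k] (μ → MvPolynomial (Fin n) k)}
    {a e : ℕ} (hf : IsHomogeneousMap f e) (hg : IsHomogeneousMap g (a + e))
    (hfg : ∀ x, g x ∈ LinearMap.range f) :
    ∃ h : (κ → MvPolynomial (Fin n) k) →ₗ[MvPolynomial (Fin n) k] (ι → MvPolynomial (Fin n) k),
      IsHomogeneousMap h a ∧ f ∘ₗ h = g := by
  obtain ⟨h, hh, H⟩ := exists_homogeneous_lift_forms (isHomogeneousMap_iff_form.1 hf)
    (isHomogeneousMap_iff_form.1 hg) fun x => (hfg x).imp fun y hy r => congrFun hy r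
  exact ⟨h, hh, LinearMap.ext fun x => funext fun r => H r x⟩

/-- A vector of constants in the image of a degree `1` map vanishes. -/
theorem eq_zero_of_mem_range [Finite ι]
    {g : (ι → MvPolynomial (Fin n) k) →ₗ[MvPolynomial (Fin n) k] (κ → MvPolynomial (Fin n) k)}
    (hg : IsHomogeneousMap g 1) {v : κ → MvPolynomial (Fin n) k}
    (hv : ∀ c, (v c).IsHomogeneous 0) (h : v ∈ LinearMap.range g) : v = 0 := by
  classical
  cases nonempty_fintype ι
  obtain ⟨u, rfl⟩ := h
  funext r
  have h0 : (g u r) = homogeneousComponent 0 (g u r) := (homogeneousComponent_eq_self (hv r)).symm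
  rw [h0, LinearMap.pi_apply_eq_sum_univ g u, Finset.sum_apply, map_sum]
  refine Finset.sum_eq_zero fun c _ => ?_
  -- Linear entries have no constant term, hence neither does any value of `g`.
  have h1 := (isHomogeneousMap_iff.1 hg c r).coeff_eq_zero (d := 0) (by simp)
  rw [homogeneousComponent_zero, Pi.smul_apply, smul_eq_mul, ← constantCoeff_eq, map_mul,
    constantCoeff_eq]
  have : (fun j => if c = j then (1 : MvPolynomial (Fin n) k) else 0) = Pi.single c 1 := by
    funext j; simp [Pi.single_apply, eq_comm]
  rw [this, h1, mul_zero, C_0]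

/-- A degree `0` map whose values on constant vectors are values of a degree `1` map vanishes. -/
theorem IsHomogeneousMap.eq_zero_of_range [Finite ι] [Finite μ]
    {f : (ι → MvPolynomial (Fin n) k) →ₗ[MvPolynomial (Fin n) k] (κ → MvPolynomial (Fin n) k)}
    {g : (μ → MvPolynomial (Fin n) k) →ₗ[MvPolynomial (Fin n) k] (κ → MvPolynomial (Fin n) k)}
    (hf : IsHomogeneousMap f 0) (hg : IsHomogeneousMap g 1)
    (h : ∀ v, (∀ c, (v c).IsHomogeneous 0) → f v ∈ LinearMap.range g) : f = 0 := by
  classical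
  cases nonempty_fintype ι
  refine (Pi.basisFun (MvPolynomial (Fin n) k) ι).ext fun c => ?_
  rw [Pi.basisFun_apply, LinearMap.zero_apply]
  exact eq_zero_of_mem_range hg (hf 0 _ (isHomogeneous_piSingle_one c))
    (h _ (isHomogeneous_piSingle_one c))

end HomogeneousMaps

/-! ### Degree `0` maps are matrices over the field -/

section ConstantMaps

variable {k : Type*} [Field k] {n : ℕ} {ι κ μ : Type*}

/-- The extension of scalars of a linear map between spaces of vectors from `k` to
`k[x_1, …, x_n]`. -/
noncomputable def extendScalars (n : ℕ) [Fintype ι] [DecidableEq ι] (f : (ι → k) →ₗ[k] (κ → k)) :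
    (ι → MvPolynomial (Fin n) k) →ₗ[MvPolynomial (Fin n) k] (κ → MvPolynomial (Fin n) k) :=
  Matrix.mulVecLin ((LinearMap.toMatrix' f).map C)

theorem extendScalars_single [Fintype ι] [DecidableEq ι] (f : (ι → k) →ₗ[k] (κ → k)) (c : ι) :
    extendScalars n f (Pi.single c 1) = fun r => C (f (Pi.single c 1) r) := by
  funext r
  simp [extendScalars, LinearMap.toMatrix'_apply]

theorem isHomogeneousMap_extendScalars [Fintype ι] [DecidableEq ι] (f : (ι → k) →ₗ[k] (κ → k)) :
    IsHomogeneousMap (extendScalars n f) 0 := by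
  rw [isHomogeneousMap_iff]
  intro c r
  rw [extendScalars_single]
  exact isHomogeneous_C _ _

theorem extendScalars_comp [Fintype ι] [DecidableEq ι] [Fintype κ] [DecidableEq κ]
    (g : (κ → k) →ₗ[k] (μ → k)) (f : (ι → k) →ₗ[k] (κ → k)) :
    extendScalars n (g ∘ₗ f) = extendScalars n g ∘ₗ extendScalars n f := by
  simp only [extendScalars, LinearMap.toMatrix'_comp, Matrix.map_mul, Matrix.mulVecLin_mul]

theorem extendScalars_id [Fintype ι] [DecidableEq ι] :
    extendScalars n (LinearMap.id : (ι → k) →ₗ[k] (ι → k)) = LinearMap.id := by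
  rw [extendScalars, LinearMap.toMatrix'_id, Matrix.map_one _ C_0 C_1, Matrix.mulVecLin_one]

theorem extendScalars_add [Fintype ι] [DecidableEq ι] (f g : (ι → k) →ₗ[k] (κ → k)) :
    extendScalars n (f + g) = extendScalars n f + extendScalars n g := by
  simp [extendScalars, Matrix.map_add, Matrix.mulVecLin_add]

theorem extendScalars_zero [Fintype ι] [DecidableEq ι] :
    extendScalars n (0 : (ι → k) →ₗ[k] (κ → k)) = 0 := by
  simp [extendScalars, Matrix.map_zero]

theorem IsHomogeneousMap.exists_extendScalars [Fintype ι] [DecidableEq ι]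
    {f : (ι → MvPolynomial (Fin n) k) →ₗ[MvPolynomial (Fin n) k] (κ → MvPolynomial (Fin n) k)}
    (hf : IsHomogeneousMap f 0) : ∃ g : (ι → k) →ₗ[k] (κ → k), extendScalars n g = f := by
  refine ⟨(Pi.basisFun k ι).constr k fun c r => coeff 0 (f (Pi.single c 1) r), ?_⟩
  refine (Pi.basisFun (MvPolynomial (Fin n) k) ι).ext fun c => ?_
  rw [Pi.basisFun_apply, extendScalars_single]
  funext r
  rw [← Pi.basisFun_apply (R := k), Module.Basis.constr_basis, ← homogeneousComponent_zero]
  exact homogeneousComponent_eq_self (isHomogeneousMap_iff.1 hf c r)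

theorem extendScalars_C [Fintype ι] [DecidableEq ι] (f : (ι → k) →ₗ[k] (κ → k)) (v : ι → k) :
    extendScalars n f (fun c => C (v c)) = fun r => C (f v r) := by
  funext r
  conv_rhs => rw [← LinearMap.toMatrix'_mulVec f v]
  simp [extendScalars, Matrix.mulVec, dotProduct]

/-- A degree `0` map that is injective on constant vectors is a split injection with a free
cokernel, and the splitting consists of degree `0` maps. -/
theorem IsHomogeneousMap.exists_splitting [Finite ι] [Finite κ]
    {f : (ι → MvPolynomial (Fin n) k) →ₗ[MvPolynomial (Fin n) k] (κ → MvPolynomial (Fin n) k)}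
    (hf : IsHomogeneousMap f 0)
    (hinj : ∀ v, (∀ c, (v c).IsHomogeneous 0) → f v = 0 → v = 0) :
    ∃ (b : ℕ)
      (ρ : (κ → MvPolynomial (Fin n) k) →ₗ[MvPolynomial (Fin n) k] (ι → MvPolynomial (Fin n) k))
      (π : (κ → MvPolynomial (Fin n) k) →ₗ[MvPolynomial (Fin n) k]
        (Fin b → MvPolynomial (Fin n) k))
      (σ : (Fin b → MvPolynomial (Fin n) k) →ₗ[MvPolynomial (Fin n) k]
        (κ → MvPolynomial (Fin n) k)),
      IsHomogeneousMap ρ 0 ∧ IsHomogeneousMap π 0 ∧ IsHomogeneousMap σ 0 ∧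
      (∀ x, ρ (f x) = x) ∧ (∀ x, π (f x) = 0) ∧ (∀ x, π (σ x) = x) ∧
      ∀ x, f (ρ x) + σ (π x) = x := by
  classical
  cases nonempty_fintype ι
  cases nonempty_fintype κ
  -- Everything happens over `k`, where an injection has a left inverse `r` and the kernel of `r` is
  -- a complement of the image. Extending scalars preserves the resulting identities.
  obtain ⟨g, rfl⟩ := hf.exists_extendScalars
  have hg : LinearMap.ker g = ⊥ := by
    refine LinearMap.ker_eq_bot'.2 fun v hv => ?_
    have h := hinj (fun c => C (v c)) (fun c => isHomogeneous_C _ _)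
      (by rw [extendScalars_C, hv]; funext r; simp)
    funext c
    exact C_injective (Fin n) k (by simpa using congrFun h c)
  obtain ⟨r, hr⟩ := g.exists_leftInverse_of_injective hg
  let W := LinearMap.ker r
  let E := (Module.finBasis k W).equivFun
  have hr' : ∀ x, r (g x) = x := fun x => LinearMap.congr_fun hr x
  let q : (κ → k) →ₗ[k] W := (LinearMap.id - g ∘ₗ r).codRestrict W fun x => by
    simp [W, LinearMap.mem_ker, hr']
  let p : (κ → k) →ₗ[k] (Fin (Module.finrank k W) → k) := E.toLinearMap ∘ₗ q
  let s : (Fin (Module.finrank k W) → k) →ₗ[k] (κ → k) := W.subtype ∘ₗ E.symm.toLinearMap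
  have hpg : p ∘ₗ g = 0 := by
    refine LinearMap.ext fun x => ?_
    have : q (g x) = 0 := by ext1; simp [q, hr']
    simp [p, this]
  have hps : p ∘ₗ s = LinearMap.id := by
    refine LinearMap.ext fun x => ?_
    have : q (s x) = E.symm x := by
      ext1
      have h : r (E.symm x : κ → k) = 0 := (E.symm x).2
      simp [q, s, h]
    simp [p, this]
  have hsum : g ∘ₗ r + s ∘ₗ p = LinearMap.id := by
    refine LinearMap.ext fun x => ?_
    simp [s, p, q]
  refine ⟨_, extendScalars n r, extendScalars n p, extendScalars n s,
    isHomogeneousMap_extendScalars _, isHomogeneousMap_extendScalars _,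
    isHomogeneousMap_extendScalars _, fun x => ?_, fun x => ?_, fun x => ?_, fun x => ?_⟩
  · rw [← LinearMap.comp_apply, ← extendScalars_comp, hr, extendScalars_id, LinearMap.id_apply]
  · rw [← LinearMap.comp_apply, ← extendScalars_comp, hpg, extendScalars_zero,
      LinearMap.zero_apply]
  · rw [← LinearMap.comp_apply, ← extendScalars_comp, hps, extendScalars_id, LinearMap.id_apply]
  · rw [← LinearMap.comp_apply, ← LinearMap.comp_apply, ← extendScalars_comp,
      ← extendScalars_comp, ← LinearMap.add_apply, ← extendScalars_add, hsum, extendScalars_id,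
      LinearMap.id_apply]

end ConstantMaps

/-! ### Chain maps and linear resolutions -/

section Resolutions

variable {k : Type*} [Field k] {n : ℕ}

theorem exists_seq_of_step {α : ℕ → Type*} {R : ∀ i, α i → α (i + 1) → Prop}
    (h : ∀ i a, ∃ b, R i a b) (a : α 0) :
    ∃ f : ∀ i, α i, f 0 = a ∧ ∀ i, R i (f i) (f (i + 1)) := by
  choose g hg using h
  exact ⟨fun i => Nat.rec a (fun i x => g i x) i, rfl, fun i => hg i _⟩

/-- A homogeneous map between the lowest terms of two complexes with linear entries, of which the
second is exact, extends to a homogeneous chain map. -/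
theorem exists_homogeneous_chainMap {φ γ : ℕ → Type} [∀ i, Finite (φ i)] [∀ i, Finite (γ i)]
    {δF : ∀ i, (φ (i + 1) → MvPolynomial (Fin n) k) →ₗ[MvPolynomial (Fin n) k]
      (φ i → MvPolynomial (Fin n) k)}
    {δG : ∀ i, (γ (i + 1) → MvPolynomial (Fin n) k) →ₗ[MvPolynomial (Fin n) k]
      (γ i → MvPolynomial (Fin n) k)}
    (hF : ∀ i, IsHomogeneousMap (δF i) 1) (hG : ∀ i, IsHomogeneousMap (δG i) 1)
    (hFF : ∀ i x, δF i (δF (i + 1) x) = 0) (hex : ∀ i, Function.Exact (δG (i + 1)) (δG i))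
    {a : ℕ} {f₀ : (φ 0 → MvPolynomial (Fin n) k) →ₗ[MvPolynomial (Fin n) k]
      (γ 0 → MvPolynomial (Fin n) k)} (hf₀ : IsHomogeneousMap f₀ a)
    (hr : ∀ x, f₀ (δF 0 x) ∈ LinearMap.range (δG 0)) :
    ∃ f : ∀ i, (φ i → MvPolynomial (Fin n) k) →ₗ[MvPolynomial (Fin n) k]
        (γ i → MvPolynomial (Fin n) k),
      f 0 = f₀ ∧ (∀ i, IsHomogeneousMap (f i) a) ∧
      ∀ i x, δG i (f (i + 1) x) = f i (δF i x) := by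
  -- The recursion must carry the condition on ranges: it is what makes the next lift possible, and
  -- exactness of the target restores it.
  let α : ℕ → Type _ := fun i => {f : (φ i → MvPolynomial (Fin n) k) →ₗ[MvPolynomial (Fin n) k]
    (γ i → MvPolynomial (Fin n) k) //
      IsHomogeneousMap f a ∧ ∀ x, f (δF i x) ∈ LinearMap.range (δG i)}
  obtain ⟨f, h0, hf⟩ := exists_seq_of_step (α := α)
    (R := fun i f g => ∀ x, δG i (g.1 x) = f.1 (δF i x)) (fun i f => by
      obtain ⟨g, hg, hg'⟩ := exists_homogeneous_lift (a := a) (hG i)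
        (add_comm 1 a ▸ f.2.1.comp (hF i))
        f.2.2
      have hg'' : ∀ x, δG i (g x) = f.1 (δF i x) := fun x => LinearMap.congr_fun hg' x
      exact ⟨⟨g, hg, fun x => (hex i _).1 (by rw [hg'', hFF, map_zero])⟩, hg''⟩) ⟨f₀, hf₀, hr⟩
  exact ⟨fun i => (f i).1, congrArg Subtype.val h0, fun i => (f i).2.1, hf⟩

/-- The maps `ε` and `δ` form an `e`-linear resolution of `I` by free modules on arbitrary index
types. -/
structure IsLinearResolution (I : Ideal (MvPolynomial (Fin n) k)) (e : ℕ) {ι : ℕ → Type}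
    (ε : (ι 0 → MvPolynomial (Fin n) k) →ₗ[MvPolynomial (Fin n) k] MvPolynomial (Fin n) k)
    (δ : ∀ i, (ι (i + 1) → MvPolynomial (Fin n) k) →ₗ[MvPolynomial (Fin n) k]
      (ι i → MvPolynomial (Fin n) k)) : Prop where
  augmentation : IsHomogeneousForm ε e
  linear : ∀ i, IsHomogeneousMap (δ i) 1
  range_eq : LinearMap.range ε = I
  exact_zero : Function.Exact (δ 0) ε
  exact_succ : ∀ i, Function.Exact (δ (i + 1)) (δ i)

theorem HasLinearResolution.exists_isLinearResolution {I : Ideal (MvPolynomial (Fin n) k)} {e : ℕ}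
    (h : HasLinearResolution I e) : ∃ (b : ℕ → ℕ)
      (ε : (Fin (b 0) → MvPolynomial (Fin n) k) →ₗ[MvPolynomial (Fin n) k] MvPolynomial (Fin n) k)
      (δ : ∀ i : ℕ, (Fin (b (i + 1)) → MvPolynomial (Fin n) k) →ₗ[MvPolynomial (Fin n) k]
        (Fin (b i) → MvPolynomial (Fin n) k)),
      IsLinearResolution (ι := fun i => Fin (b i)) I e ε δ := by
  obtain ⟨b, ε, δ, h1, h2, h3, h4, h5⟩ := h
  exact ⟨b, ε, δ, isHomogeneousForm_iff.2 h1, fun i => isHomogeneousMap_iff.2 (h2 i), h3, h4, h5⟩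

theorem isHomogeneousMap_funCongrLeft {ι κ : Type*} (f : ι ≃ κ) :
    IsHomogeneousMap (LinearEquiv.funCongrLeft (MvPolynomial (Fin n) k)
      (MvPolynomial (Fin n) k) f).toLinearMap 0 := fun _ _ hv _ => hv _

theorem IsLinearResolution.hasLinearResolution {I : Ideal (MvPolynomial (Fin n) k)} {e : ℕ}
    {ι : ℕ → Type} [∀ i, Finite (ι i)]
    {ε : (ι 0 → MvPolynomial (Fin n) k) →ₗ[MvPolynomial (Fin n) k] MvPolynomial (Fin n) k}
    {δ : ∀ i, (ι (i + 1) → MvPolynomial (Fin n) k) →ₗ[MvPolynomial (Fin n) k]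
      (ι i → MvPolynomial (Fin n) k)} (h : IsLinearResolution I e ε δ) :
    HasLinearResolution I e := by
  let f : ∀ i, ι i ≃ Fin (Nat.card (ι i)) := fun i => Finite.equivFin (ι i)
  let E := fun i => LinearEquiv.funCongrLeft (MvPolynomial (Fin n) k)
      (MvPolynomial (Fin n) k) (f i)
  have hE : ∀ i, IsHomogeneousMap (E i).toLinearMap 0 := fun i => isHomogeneousMap_funCongrLeft _
  have hE' : ∀ i, IsHomogeneousMap (E i).symm.toLinearMap 0 :=
    fun i => isHomogeneousMap_funCongrLeft (f i).symm
  refine ⟨fun i => Nat.card (ι i), ε ∘ₗ (E 0).toLinearMap,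
    fun i => (E i).symm.toLinearMap ∘ₗ δ i ∘ₗ (E (i + 1)).toLinearMap, ?_, fun i => ?_, ?_, ?_,
    fun i => ?_⟩
  · exact isHomogeneousForm_iff.1 (by simpa using h.augmentation.comp (hE 0))
  · exact isHomogeneousMap_iff.1 (by simpa using (hE' i).comp ((h.linear i).comp (hE (i + 1))))
  · rw [LinearMap.range_comp_of_range_eq_top _ (LinearEquiv.range _), h.range_eq]
  · intro y
    simp only [LinearMap.comp_apply, LinearEquiv.coe_coe, Set.mem_range]
    rw [h.exact_zero]
    constructor
    · rintro ⟨x, hx⟩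
      exact ⟨(E 1).symm x, by simp [hx]⟩
    · rintro ⟨x, rfl⟩
      exact ⟨E 1 x, by simp⟩
  · intro y
    simp only [LinearMap.comp_apply, LinearEquiv.coe_coe, Set.mem_range]
    rw [LinearEquiv.map_eq_zero_iff, h.exact_succ]
    constructor
    · rintro ⟨x, hx⟩
      exact ⟨(E (i + 2)).symm x, by simp [hx]⟩
    · rintro ⟨x, rfl⟩
      exact ⟨E (i + 2) x, by simp⟩

end Resolutions

/-! ### Mapping cones: from the intersection to the sum -/

section MappingCone

variable {k : Type*} [Field k] {n : ℕ}

/-- The block triangular map `(x, y) ↦ (f x + h y, g y)`. -/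
noncomputable def blockMap {α α' β β' : Type*}
    (f : (α → MvPolynomial (Fin n) k) →ₗ[MvPolynomial (Fin n) k] (α' → MvPolynomial (Fin n) k))
    (h : (β → MvPolynomial (Fin n) k) →ₗ[MvPolynomial (Fin n) k] (α' → MvPolynomial (Fin n) k))
    (g : (β → MvPolynomial (Fin n) k) →ₗ[MvPolynomial (Fin n) k] (β' → MvPolynomial (Fin n) k)) :
    (α ⊕ β → MvPolynomial (Fin n) k) →ₗ[MvPolynomial (Fin n) k]
      (α' ⊕ β' → MvPolynomial (Fin n) k) where
  toFun v := Sum.elim (f (v ∘ Sum.inl) + h (v ∘ Sum.inr)) (g (v ∘ Sum.inr))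
  map_add' u v := by
    have h1 : (u + v) ∘ Sum.inl = u ∘ Sum.inl + v ∘ Sum.inl := rfl
    have h2 : (u + v) ∘ Sum.inr = u ∘ Sum.inr + v ∘ Sum.inr := rfl
    rw [h1, h2]
    funext r
    rcases r with r | r
    · simp only [map_add, Sum.elim_inl, Pi.add_apply]; ring
    · simp only [map_add, Sum.elim_inr, Pi.add_apply]
  map_smul' c v := by
    have h1 : (c • v) ∘ Sum.inl = c • v ∘ Sum.inl := rfl
    have h2 : (c • v) ∘ Sum.inr = c • v ∘ Sum.inr := rfl
    rw [h1, h2]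
    funext r
    rcases r with r | r <;> simp [mul_add]

theorem blockMap_apply {α α' β β' : Type*}
    (f : (α → MvPolynomial (Fin n) k) →ₗ[MvPolynomial (Fin n) k] (α' → MvPolynomial (Fin n) k))
    (h : (β → MvPolynomial (Fin n) k) →ₗ[MvPolynomial (Fin n) k] (α' → MvPolynomial (Fin n) k))
    (g : (β → MvPolynomial (Fin n) k) →ₗ[MvPolynomial (Fin n) k] (β' → MvPolynomial (Fin n) k))
    (x : α → MvPolynomial (Fin n) k) (y : β → MvPolynomial (Fin n) k) :
    blockMap f h g (Sum.elim x y) = Sum.elim (f x + h y) (g y) := rfl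

theorem isHomogeneousMap_blockMap {α α' β β' : Type*}
    {f : (α → MvPolynomial (Fin n) k) →ₗ[MvPolynomial (Fin n) k] (α' → MvPolynomial (Fin n) k)}
    {h : (β → MvPolynomial (Fin n) k) →ₗ[MvPolynomial (Fin n) k] (α' → MvPolynomial (Fin n) k)}
    {g : (β → MvPolynomial (Fin n) k) →ₗ[MvPolynomial (Fin n) k] (β' → MvPolynomial (Fin n) k)}
    {e : ℕ} (hf : IsHomogeneousMap f e) (hh : IsHomogeneousMap h e) (hg : IsHomogeneousMap g e) :
    IsHomogeneousMap (blockMap f h g) e := by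
  rintro a v hv (r | r)
  · exact (hf a _ (fun c => hv _) r).add (hh a _ (fun c => hv _) r)
  · exact hg a _ (fun c => hv _) r

theorem forall_sum_elim {α β M : Type*} {p : (α ⊕ β → M) → Prop} :
    (∀ v, p v) ↔ ∀ x y, p (Sum.elim x y) :=
  ⟨fun h _ _ => h _, fun h v => by rw [← Sum.elim_comp_inl_inr v]; exact h _ _⟩

theorem sum_elim_inj {α β M : Type*} {x x' : α → M} {y y' : β → M} :
    Sum.elim x y = Sum.elim x' y' ↔ x = x' ∧ y = y' :=
  ⟨fun h => ⟨funext fun c => congrFun h (Sum.inl c), funext fun c => congrFun h (Sum.inr c)⟩,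
    fun h => by rw [h.1, h.2]⟩

theorem sum_elim_eq_zero {α β M : Type*} [Zero M] {x : α → M} {y : β → M} :
    Sum.elim x y = 0 ↔ x = 0 ∧ y = 0 := by
  rw [← Sum.elim_zero_zero, sum_elim_inj]

/-- The maps `ε₁`, `ε₂` and `δ` form a `d`-linear resolution of the module `A ⊕ B`. -/
structure IsPairResolution (A B : Ideal (MvPolynomial (Fin n) k)) (d : ℕ) {γ : ℕ → Type}
    (ε₁ ε₂ : (γ 0 → MvPolynomial (Fin n) k) →ₗ[MvPolynomial (Fin n) k] MvPolynomial (Fin n) k)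
    (δ : ∀ i, (γ (i + 1) → MvPolynomial (Fin n) k) →ₗ[MvPolynomial (Fin n) k]
      (γ i → MvPolynomial (Fin n) k)) : Prop where
  homogeneous₁ : IsHomogeneousForm ε₁ d
  homogeneous₂ : IsHomogeneousForm ε₂ d
  linear : ∀ i, IsHomogeneousMap (δ i) 1
  mem₁ : ∀ v, ε₁ v ∈ A
  mem₂ : ∀ v, ε₂ v ∈ B
  surjective : ∀ a ∈ A, ∀ b ∈ B, ∃ v, ε₁ v = a ∧ ε₂ v = b
  exact_zero : ∀ v, (ε₁ v = 0 ∧ ε₂ v = 0) ↔ v ∈ Set.range (δ 0)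
  exact_succ : ∀ i, Function.Exact (δ (i + 1)) (δ i)

/-- The direct sum of the two resolutions. Its augmentation is kept as two forms, so that all maps
stay between free modules. -/
theorem exists_isPairResolution {A B : Ideal (MvPolynomial (Fin n) k)} {d : ℕ}
    (hA : HasLinearResolution A d) (hB : HasLinearResolution B d) :
    ∃ (γ : ℕ → Type) (_ : ∀ i, Finite (γ i))
      (ε₁ ε₂ : (γ 0 → MvPolynomial (Fin n) k) →ₗ[MvPolynomial (Fin n) k] MvPolynomial (Fin n) k)
      (δ : ∀ i, (γ (i + 1) → MvPolynomial (Fin n) k) →ₗ[MvPolynomial (Fin n) k]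
        (γ i → MvPolynomial (Fin n) k)), IsPairResolution A B d ε₁ ε₂ δ := by
  obtain ⟨b, εA, δA, h⟩ := hA.exists_isLinearResolution
  obtain ⟨c, εB, δB, h'⟩ := hB.exists_isLinearResolution
  have hex : ∀ {α α' α'' β β' β'' : Type} {f' : (α'' → MvPolynomial (Fin n) k) →ₗ[
        MvPolynomial (Fin n) k] (α → MvPolynomial (Fin n) k)}
      {f : (α → MvPolynomial (Fin n) k) →ₗ[MvPolynomial (Fin n) k] (α' → MvPolynomial (Fin n) k)}
      {g' : (β'' → MvPolynomial (Fin n) k) →ₗ[MvPolynomial (Fin n) k] (β → MvPolynomial (Fin n) k)}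
      {g : (β → MvPolynomial (Fin n) k) →ₗ[MvPolynomial (Fin n) k] (β' → MvPolynomial (Fin n) k)},
      Function.Exact f' f → Function.Exact g' g →
      Function.Exact (blockMap f' 0 g') (blockMap f 0 g) := by
    intro α α' α'' β β' β'' f' f g' g hf hg
    refine forall_sum_elim.2 fun x y => ?_
    rw [blockMap_apply, sum_elim_eq_zero, LinearMap.zero_apply, add_zero, hf, hg]
    constructor
    · rintro ⟨⟨u, rfl⟩, ⟨v, rfl⟩⟩
      exact ⟨Sum.elim u v, by rw [blockMap_apply, LinearMap.zero_apply, add_zero]⟩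
    · rintro ⟨w, hw⟩
      rw [← Sum.elim_comp_inl_inr w, blockMap_apply, LinearMap.zero_apply, add_zero,
        sum_elim_inj] at hw
      exact ⟨⟨_, hw.1⟩, ⟨_, hw.2⟩⟩
  refine ⟨fun i => Fin (b i) ⊕ Fin (c i), fun i => inferInstance,
    εA ∘ₗ LinearMap.funLeft _ _ Sum.inl, εB ∘ₗ LinearMap.funLeft _ _ Sum.inr,
    fun i => blockMap (δA i) 0 (δB i), ?_⟩
  refine ⟨fun a v hv => h.augmentation a _ fun c => hv _,
    fun a v hv => h'.augmentation a _ fun c => hv _, fun i => isHomogeneousMap_blockMap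
    (h.linear i) (fun _ _ _ _ => isHomogeneous_zero _ _ _) (h'.linear i), fun v => ?_, fun v => ?_,
    ?_, forall_sum_elim.2 fun x y => ?_, fun i => hex (h.exact_succ i) (h'.exact_succ i)⟩
  · rw [← h.range_eq]; exact ⟨_, rfl⟩
  · rw [← h'.range_eq]; exact ⟨_, rfl⟩
  · rw [← h.range_eq, ← h'.range_eq]
    rintro _ ⟨x, rfl⟩ _ ⟨y, rfl⟩
    exact ⟨Sum.elim x y, rfl, rfl⟩
  · change (εA x = 0 ∧ εB y = 0) ↔ _
    rw [h.exact_zero, h'.exact_zero]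
    constructor
    · rintro ⟨⟨u, rfl⟩, ⟨v, rfl⟩⟩
      exact ⟨Sum.elim u v, by rw [blockMap_apply, LinearMap.zero_apply, add_zero]⟩
    · rintro ⟨w, hw⟩
      rw [← Sum.elim_comp_inl_inr w, blockMap_apply, LinearMap.zero_apply, add_zero,
        sum_elim_inj] at hw
      exact ⟨⟨_, hw.1⟩, ⟨_, hw.2⟩⟩

/-- The index types of the bases of the terms of a mapping cone. -/
def coneIndex (γ φ : ℕ → Type) : ℕ → Type
  | 0 => γ 0
  | i + 1 => γ (i + 1) ⊕ φ i

instance {γ φ : ℕ → Type} [∀ i, Finite (γ i)] [∀ i, Finite (φ i)] :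
    ∀ i, Finite (coneIndex γ φ i)
  | 0 => inferInstanceAs (Finite (γ 0))
  | i + 1 => inferInstanceAs (Finite (γ (i + 1) ⊕ φ i))

/-- The lowest differential `(x, y) ↦ δ x + f y` of a mapping cone. -/
noncomputable def coneBase {α α' β : Type*}
    (f : (α → MvPolynomial (Fin n) k) →ₗ[MvPolynomial (Fin n) k] (α' → MvPolynomial (Fin n) k))
    (h : (β → MvPolynomial (Fin n) k) →ₗ[MvPolynomial (Fin n) k] (α' → MvPolynomial (Fin n) k)) :
    (α ⊕ β → MvPolynomial (Fin n) k) →ₗ[MvPolynomial (Fin n) k] (α' → MvPolynomial (Fin n) k) :=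
  f ∘ₗ LinearMap.funLeft _ _ Sum.inl + h ∘ₗ LinearMap.funLeft _ _ Sum.inr

theorem coneBase_apply {α α' β : Type*}
    (f : (α → MvPolynomial (Fin n) k) →ₗ[MvPolynomial (Fin n) k] (α' → MvPolynomial (Fin n) k))
    (h : (β → MvPolynomial (Fin n) k) →ₗ[MvPolynomial (Fin n) k] (α' → MvPolynomial (Fin n) k))
    (x : α → MvPolynomial (Fin n) k) (y : β → MvPolynomial (Fin n) k) :
    coneBase f h (Sum.elim x y) = f x + h y := rfl

/-- The differentials of the mapping cone of the chain map `f`. -/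
noncomputable def coneDiff {γ φ : ℕ → Type}
    (δF : ∀ i, (φ (i + 1) → MvPolynomial (Fin n) k) →ₗ[MvPolynomial (Fin n) k]
      (φ i → MvPolynomial (Fin n) k))
    (δG : ∀ i, (γ (i + 1) → MvPolynomial (Fin n) k) →ₗ[MvPolynomial (Fin n) k]
      (γ i → MvPolynomial (Fin n) k))
    (f : ∀ i, (φ i → MvPolynomial (Fin n) k) →ₗ[MvPolynomial (Fin n) k]
      (γ i → MvPolynomial (Fin n) k)) :
    ∀ i, (coneIndex γ φ (i + 1) → MvPolynomial (Fin n) k) →ₗ[MvPolynomial (Fin n) k]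
      (coneIndex γ φ i → MvPolynomial (Fin n) k)
  | 0 => coneBase (δG 0) (f 0)
  | i + 1 => blockMap (δG (i + 1)) (f (i + 1)) (-δF i)

/-- The mapping cone of a lift of `A ⊓ B → A ⊕ B` resolves `A + B`. -/
theorem hasLinearResolution_add {A B : Ideal (MvPolynomial (Fin n) k)} {d : ℕ}
    (hA : HasLinearResolution A d) (hB : HasLinearResolution B d)
    (hAB : HasLinearResolution (A ⊓ B) (d + 1)) : HasLinearResolution (A + B) d := by
  obtain ⟨γ, _, ε₁, ε₂, δG, hG⟩ := exists_isPairResolution hA hB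
  obtain ⟨b, ε, δF, hF⟩ := hAB.exists_isLinearResolution
  have hmem : ∀ x, ε x ∈ A ⊓ B := fun x => hF.range_eq ▸ LinearMap.mem_range_self ε x
  have hGG : ∀ i x, δG i (δG (i + 1) x) = 0 := fun i x => (hG.exact_succ i _).2 ⟨x, rfl⟩
  have hFF : ∀ i x, δF i (δF (i + 1) x) = 0 := fun i x => (hF.exact_succ i _).2 ⟨x, rfl⟩
  -- A lift of `p ↦ (p, -p)`. It has degree `1` because the generators of `A ⊓ B` sit one degree
  -- higher, so it contributes linear entries to the cone.
  obtain ⟨f₀, hf₀, hf₀'⟩ := exists_homogeneous_lift_forms (μ := Bool) (a := 1) (e := d)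
    (f := fun r => bif r then ε₁ else ε₂) (g := fun r => bif r then ε else -ε)
    (Bool.rec hG.homogeneous₂ hG.homogeneous₁)
    (Bool.rec (by simpa [add_comm] using hF.augmentation.neg)
      (by simpa [add_comm] using hF.augmentation))
    (fun x => by
      obtain ⟨v, h1, h2⟩ := hG.surjective _ (hmem x).1 _ (neg_mem (hmem x).2)
      exact ⟨v, Bool.rec h2 h1⟩)
  have he₁ : ∀ x, ε₁ (f₀ x) = ε x := hf₀' true
  have he₂ : ∀ x, ε₂ (f₀ x) = -ε x := hf₀' false
  obtain ⟨f, rfl, hf, hcomm⟩ := exists_homogeneous_chainMap (φ := fun i => Fin (b i))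
    hF.linear hG.linear hFF hG.exact_succ hf₀ (fun x => by
      refine (hG.exact_zero _).1 ?_
      rw [he₁, he₂, (hF.exact_zero _).2 ⟨x, rfl⟩, neg_zero]
      exact ⟨rfl, rfl⟩)
  have hrange : LinearMap.range (ε₁ + ε₂) = A + B := by
    ext p
    rw [Submodule.add_eq_sup, Submodule.mem_sup]
    constructor
    · rintro ⟨v, rfl⟩
      exact ⟨_, hG.mem₁ v, _, hG.mem₂ v, rfl⟩
    · rintro ⟨a, ha, c, hc, rfl⟩
      obtain ⟨v, h1, h2⟩ := hG.surjective a ha c hc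
      exact ⟨v, by rw [LinearMap.add_apply, h1, h2]⟩
  have hexact : ∀ v, (ε₁ + ε₂) v = 0 ↔ v ∈ Set.range (coneBase (δG 0) (f 0)) := by
    intro v
    rw [LinearMap.add_apply]
    constructor
    · intro h
      have h' := eq_neg_of_add_eq_zero_right h
      have hv : ε₁ v ∈ A ⊓ B := by
        refine ⟨hG.mem₁ v, ?_⟩
        rw [← neg_neg (ε₁ v), ← h']
        exact neg_mem (S := Ideal (MvPolynomial (Fin n) k)) (hG.mem₂ v)
      rw [← hF.range_eq] at hv
      obtain ⟨y, hy⟩ := hv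
      obtain ⟨x, hx⟩ := (hG.exact_zero (v - f 0 y)).1
        ⟨by rw [map_sub, he₁, hy, sub_self], by rw [map_sub, he₂, hy, h', sub_self]⟩
      exact ⟨Sum.elim x y, by rw [coneBase_apply, hx, sub_add_cancel]⟩
    · rintro ⟨w, rfl⟩
      revert w
      refine forall_sum_elim.2 fun x y => ?_
      obtain ⟨h1, h2⟩ := (hG.exact_zero _).2 ⟨x, rfl⟩
      rw [coneBase_apply, map_add, map_add, he₁, he₂, h1, h2]
      ring
  refine IsLinearResolution.hasLinearResolution (ι := coneIndex γ fun i => Fin (b i))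
    (ε := ε₁ + ε₂) (δ := coneDiff δF δG f)
    ⟨hG.homogeneous₁.add hG.homogeneous₂, ?_, hrange, hexact, ?_⟩
  · rintro (_ | i)
    · exact fun a v hv r => (hG.linear 0 a _ (fun c => hv _) r).add (hf 0 a _ (fun c => hv _) r)
    · exact isHomogeneousMap_blockMap (hG.linear _) (hf _)
        fun a v hv r => (hF.linear _ a v hv r).neg
  -- The common core of exactness at all positive spots of the cone: correct `y` by a boundary
  -- first, then use exactness of `δG`. The sign in `-δF i` accounts for `-y'`.
  · have key : ∀ i x y, (δG i x + f i y = 0 ∧ (y ∈ Set.range (δF i))) ↔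
        ∃ x' y', δG (i + 1) x' + f (i + 1) y' = x ∧ -δF i y' = y := by
      intro i x y
      constructor
      · rintro ⟨h1, y', rfl⟩
        rw [← hcomm, ← map_add] at h1
        obtain ⟨x', hx'⟩ := (hG.exact_succ i _).1 h1
        exact ⟨x', -y', by rw [hx', map_neg]; abel, by simp⟩
      · rintro ⟨x', y', rfl, rfl⟩
        refine ⟨?_, -y', map_neg _ _⟩
        rw [map_add, hGG, hcomm, map_neg]
        abel
    rintro (_ | i)
    · refine forall_sum_elim.2 fun x y => ?_
      change δG 0 x + f 0 y = 0 ↔ Sum.elim x y ∈ Set.range (blockMap (δG 1) (f 1) (-δF 0))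
      -- Here the cone has no second component to force `y` into the range; applying `ε₁` gives `ε y
      -- = 0` instead.
      have hy : δG 0 x + f 0 y = 0 → y ∈ Set.range (δF 0) := fun h => by
        have h1 := congrArg ε₁ h
        rw [map_add, he₁, ((hG.exact_zero _).2 ⟨x, rfl⟩).1, zero_add, map_zero] at h1
        exact (hF.exact_zero y).1 h1
      rw [← and_iff_left_of_imp hy, key]
      constructor
      · rintro ⟨x', y', h1, h2⟩
        exact ⟨Sum.elim x' y', by rw [blockMap_apply, sum_elim_inj]; exact ⟨h1, h2⟩⟩
      · rintro ⟨w, hw⟩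
        rw [← Sum.elim_comp_inl_inr w, blockMap_apply, sum_elim_inj] at hw
        exact ⟨_, _, hw.1, hw.2⟩
    · refine forall_sum_elim.2 fun x y => ?_
      change blockMap (δG (i + 1)) (f (i + 1)) (-δF i) (Sum.elim x y) = 0 ↔
        Sum.elim x y ∈ Set.range (blockMap (δG (i + 2)) (f (i + 2)) (-δF (i + 1)))
      rw [blockMap_apply, sum_elim_eq_zero, LinearMap.neg_apply, neg_eq_zero, hF.exact_succ, key]
      constructor
      · rintro ⟨x', y', h1, h2⟩
        exact ⟨Sum.elim x' y', by rw [blockMap_apply, sum_elim_inj]; exact ⟨h1, h2⟩⟩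
      · rintro ⟨w, hw⟩
        rw [← Sum.elim_comp_inl_inr w, blockMap_apply, sum_elim_inj] at hw
        exact ⟨_, _, hw.1, hw.2⟩

end MappingCone

/-! ### Cokernels: from the sum to the intersection -/

section Intersection

variable {k : Type*} [Field k] {n : ℕ}

/-- If `A`, `B` and `A + B` have `d`-linear resolutions and `A ⊓ B` has no nonzero homogeneous
elements of degree `d`, then the cokernel of the map of resolutions induced by `A ⊕ B → A + B`
resolves `A ⊓ B`. -/
theorem hasLinearResolution_inf {A B : Ideal (MvPolynomial (Fin n) k)} {d : ℕ}
    (hA : HasLinearResolution A d) (hB : HasLinearResolution B d)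
    (hAB : HasLinearResolution (A + B) d)
    (h0 : ∀ p ∈ A ⊓ B, p.IsHomogeneous d → p = 0) : HasLinearResolution (A ⊓ B) (d + 1) := by
  obtain ⟨γ, _, ε₁, ε₂, δG, hG⟩ := exists_isPairResolution hA hB
  obtain ⟨b, ε, δH, hH⟩ := hAB.exists_isLinearResolution
  have hGG : ∀ i x, δG i (δG (i + 1) x) = 0 := fun i x => (hG.exact_succ i _).2 ⟨x, rfl⟩
  have hHH : ∀ i x, δH i (δH (i + 1) x) = 0 := fun i x => (hH.exact_succ i _).2 ⟨x, rfl⟩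
  have hinf : ∀ v, ε₁ v + ε₂ v = 0 → ε₁ v ∈ A ⊓ B := by
    intro v h
    refine ⟨hG.mem₁ v, ?_⟩
    rw [eq_neg_of_add_eq_zero_left h]
    exact neg_mem (S := Ideal (MvPolynomial (Fin n) k)) (hG.mem₂ v)
  -- The map `A ⊕ B → A + B` lifts to an isomorphism of the generating free modules.
  obtain ⟨f₀, hf₀, hef⟩ := exists_homogeneous_lift_forms (μ := Unit) (a := 0) (e := d)
    (f := fun _ => ε) (g := fun _ => ε₁ + ε₂) (fun _ => hH.augmentation)
    (fun _ => by simpa using hG.homogeneous₁.add hG.homogeneous₂)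
    (fun x => by
      have : (ε₁ + ε₂) x ∈ LinearMap.range ε := by
        rw [hH.range_eq]
        exact Submodule.add_mem_sup (hG.mem₁ x) (hG.mem₂ x)
      exact this.imp fun y hy _ => hy)
  replace hef := hef ()
  obtain ⟨g₀, hg₀, heg⟩ := exists_homogeneous_lift_forms (μ := Unit) (a := 0) (e := d)
    (f := fun _ => ε₁ + ε₂) (g := fun _ => ε)
    (fun _ => hG.homogeneous₁.add hG.homogeneous₂)
    (fun _ => by simpa using hH.augmentation)
    (fun x => by
      have : ε x ∈ A + B := hH.range_eq ▸ LinearMap.mem_range_self ε x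
      obtain ⟨a, ha, c, hc, h⟩ := Submodule.mem_sup.1 this
      obtain ⟨v, h1, h2⟩ := hG.surjective a ha c hc
      exact ⟨v, fun _ => by rw [LinearMap.add_apply, h1, h2, h]⟩)
  replace heg := heg ()
  -- The difference with the identity has degree `0` and lands in the kernel of `ε`, the image of a
  -- linear map, so it vanishes by minimality.
  have hfg : ∀ x, f₀ (g₀ x) = x := by
    have := IsHomogeneousMap.eq_zero_of_range (f := f₀ ∘ₗ g₀ - LinearMap.id)
      ((hf₀.comp hg₀).sub isHomogeneousMap_id) (hH.linear 0) fun v _ =>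
        (hH.exact_zero _).1 (by simp [hef, heg])
    exact fun x => sub_eq_zero.1 (LinearMap.congr_fun this x)
  have hgf : ∀ x, g₀ (f₀ x) = x := by
    have := IsHomogeneousMap.eq_zero_of_range (f := g₀ ∘ₗ f₀ - LinearMap.id)
      ((hg₀.comp hf₀).sub isHomogeneousMap_id) (hG.linear 0) fun v hv => by
        obtain ⟨u, hu⟩ : ∃ u, u = g₀ (f₀ v) - v := ⟨_, rfl⟩
        change g₀ (f₀ v) - v ∈ LinearMap.range (δG 0)
        have hu0 : ∀ c, (u c).IsHomogeneous 0 :=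
          hu ▸ ((hg₀.comp hf₀).sub isHomogeneousMap_id) 0 v hv
        have hsum : ε₁ u + ε₂ u = 0 := by
          rw [← LinearMap.add_apply, hu, map_sub, heg, hef, sub_self]
        rw [← hu]
        -- A constant vector killed by `ε₁ + ε₂` gives a degree `d` element of `A ⊓ B`; this is
        -- where its vanishing enters.
        have h1 : ε₁ u = 0 := h0 _ (hinf u hsum) (by simpa using hG.homogeneous₁ 0 u hu0)
        exact (hG.exact_zero _).1 ⟨h1, by rwa [h1, zero_add] at hsum⟩
    exact fun x => sub_eq_zero.1 (LinearMap.congr_fun this x)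
  obtain ⟨f, rfl, hf, hcomm⟩ := exists_homogeneous_chainMap (γ := fun i => Fin (b i))
    hG.linear hH.linear hGG hH.exact_succ hf₀ (fun x => by
      refine (hH.exact_zero _).1 ?_
      obtain ⟨h1, h2⟩ := (hG.exact_zero _).2 ⟨x, rfl⟩
      rw [hef, LinearMap.add_apply, h1, h2, add_zero])
  -- A constant vector killed by `f (i + 1)` is a cycle because `f i` is injective, hence a
  -- boundary, hence zero by minimality.
  have hstep : ∀ i, Function.Injective (f i) →
      ∀ v, (∀ c, (v c).IsHomogeneous 0) → f (i + 1) v = 0 → v = 0 := by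
    intro i hi v hv hfv
    refine eq_zero_of_mem_range (hG.linear (i + 1)) hv ((hG.exact_succ i v).1 (hi ?_))
    rw [← hcomm, hfv, map_zero, map_zero]
  have hinj : ∀ i, Function.Injective (f i) := by
    intro i
    induction i with
    | zero => exact Function.LeftInverse.injective hgf
    | succ i ih =>
      obtain ⟨_, ρ, _, _, _, _, _, h, _⟩ := (hf (i + 1)).exists_splitting (hstep i ih)
      exact Function.LeftInverse.injective h
  choose c ρ π σ _ hπ hσ hρf hπf hπσ hsum using
    fun i => (hf (i + 1)).exists_splitting (hstep i (hinj i))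
  have hker : ∀ i y, π i y = 0 → ∃ z, f (i + 1) z = y := fun i y hy =>
    ⟨ρ i y, by simpa [hy] using hsum i y⟩
  have hσπ : ∀ i y, ∃ z, σ i (π i y) = y - f (i + 1) z := fun i y =>
    ⟨ρ i y, eq_sub_of_add_eq' (hsum i y)⟩
  -- The cokernel differentials, and likewise the augmentation in `hε`, may be computed on any
  -- representative `y`.
  have hδ : ∀ i y, π i (δH (i + 1) (σ (i + 1) (π (i + 1) y))) = π i (δH (i + 1) y) := by
    intro i y
    obtain ⟨z, hz⟩ := hσπ (i + 1) y
    rw [hz, map_sub, map_sub, hcomm, hπf, sub_zero]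
  have hε : ∀ y, ε₁ (g₀ (δH 0 (σ 0 (π 0 y)))) = ε₁ (g₀ (δH 0 y)) := by
    intro y
    obtain ⟨z, hz⟩ := hσπ 0 y
    rw [hz, map_sub, map_sub, map_sub, hcomm, hgf, ((hG.exact_zero _).2 ⟨z, rfl⟩).1, sub_zero]
  have hεg : ∀ y, ε₁ (g₀ (δH 0 y)) + ε₂ (g₀ (δH 0 y)) = 0 := by
    intro y
    rw [← LinearMap.add_apply, heg]
    exact (hH.exact_zero _).2 ⟨y, rfl⟩
  -- The augmentation is the connecting map of the snake lemma: apply `δH 0`, pull back along the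
  -- isomorphism `f 0`, and take the `A`-coordinate. The factor `δH 0` raises the degree from `d` to
  -- `d + 1`.
  refine IsLinearResolution.hasLinearResolution (ι := fun i => Fin (c i))
    (ε := ε₁ ∘ₗ g₀ ∘ₗ δH 0 ∘ₗ σ 0) (δ := fun i => π i ∘ₗ δH (i + 1) ∘ₗ σ (i + 1))
    ⟨?_, ?_, ?_, ?_, ?_⟩
  · simpa [add_comm] using hG.homogeneous₁.comp (hg₀.comp ((hH.linear 0).comp (hσ 0)))
  · intro i
    simpa using (hπ i).comp ((hH.linear (i + 1)).comp (hσ (i + 1)))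
  · ext p
    constructor
    · rintro ⟨x, rfl⟩
      exact hinf _ (hεg _)
    · rintro ⟨hpA, hpB⟩
      obtain ⟨v, h1, h2⟩ := hG.surjective p hpA (-p) (neg_mem hpB)
      obtain ⟨y, hy⟩ := (hH.exact_zero (f 0 v)).1
        (by rw [hef, LinearMap.add_apply, h1, h2, add_neg_cancel])
      refine ⟨π 0 y, ?_⟩
      simp only [LinearMap.comp_apply]
      rw [hε, hy, hgf, h1]
  · intro x
    simp only [LinearMap.comp_apply, Set.mem_range]
    constructor
    · intro h
      have h2 := hεg (σ 0 x)
      rw [h, zero_add] at h2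
      obtain ⟨z, hz⟩ := (hG.exact_zero _).1 ⟨h, h2⟩
      obtain ⟨y, hy⟩ := (hH.exact_succ 0 (σ 0 x - f 1 z)).1 (by
        rw [map_sub, hcomm, hz, hfg, sub_self])
      refine ⟨π 1 y, ?_⟩
      rw [hδ, hy, map_sub, hπσ, hπf, sub_zero]
    · rintro ⟨y, rfl⟩
      rw [hε, hHH, map_zero, map_zero]
  · intro i x
    simp only [LinearMap.comp_apply, Set.mem_range]
    constructor
    · intro h
      obtain ⟨z, hz⟩ := hker i _ h
      obtain ⟨z', hz'⟩ := (hG.exact_succ i z).1 (hinj i (by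
        rw [← hcomm, hz, hHH, map_zero]))
      obtain ⟨y, hy⟩ := (hH.exact_succ (i + 1) (σ (i + 1) x - f (i + 2) z')).1 (by
        rw [map_sub, hcomm, hz', hz, sub_self])
      refine ⟨π (i + 2) y, ?_⟩
      rw [hδ, hy, map_sub, hπσ, hπf, sub_zero]
    · rintro ⟨y, rfl⟩
      rw [hδ, hHH, map_zero]

end Intersection

/-! ### Monomial ideals with linear quotients -/

section LinearQuotients

variable {k : Type*} [Field k] {n : ℕ}

theorem hasLinearResolution_bot (e : ℕ) :
    HasLinearResolution (⊥ : Ideal (MvPolynomial (Fin n) k)) e :=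
  IsLinearResolution.hasLinearResolution (ι := fun _ => Empty) (ε := 0) (δ := fun _ => 0)
    ⟨fun _ _ _ => isHomogeneous_zero _ _ _, fun _ _ _ _ _ => isHomogeneous_zero _ _ _,
      LinearMap.range_zero, fun _ => ⟨fun _ => ⟨0, Subsingleton.elim _ _⟩, fun _ => rfl⟩,
      fun _ _ => ⟨fun _ => ⟨0, Subsingleton.elim _ _⟩, fun _ => Subsingleton.elim _ _⟩⟩

theorem hasLinearResolution_top :
    HasLinearResolution (⊤ : Ideal (MvPolynomial (Fin n) k)) 0 := by
  let ι : ℕ → Type := fun i => Fin (if i = 0 then 1 else 0)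
  have hι : ∀ i, Subsingleton (ι (i + 1) → MvPolynomial (Fin n) k) := fun i => by
    have : IsEmpty (ι (i + 1)) := by simpa [ι] using Fin.isEmpty
    infer_instance
  refine IsLinearResolution.hasLinearResolution (ι := ι)
    (ε := LinearMap.proj (0 : Fin 1)) (δ := fun _ => 0)
    ⟨fun _ _ hv => hv _, fun _ _ _ _ _ => isHomogeneous_zero _ _ _, ?_, fun v => ?_, fun i v => ?_⟩
  · exact LinearMap.range_eq_top.2 fun p => ⟨fun _ => p, rfl⟩
  · refine ⟨fun h => ⟨0, ?_⟩, ?_⟩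
    · funext c
      have : c = (0 : Fin 1) := Subsingleton.elim (α := Fin 1) c 0
      rw [this]
      exact h.symm
    · rintro ⟨_, rfl⟩
      rfl
  · have := hι i
    exact ⟨fun _ => ⟨0, Subsingleton.elim _ _⟩, fun _ => rfl⟩

/-- Multiplication by `p` is injective, so the differentials stay and only the augmentation is
rescaled. -/
theorem HasLinearResolution.span_singleton_mul {I : Ideal (MvPolynomial (Fin n) k)} {e : ℕ}
    (h : HasLinearResolution I e) {p : MvPolynomial (Fin n) k} (hp0 : p ≠ 0) {d : ℕ}
    (hp : p.IsHomogeneous d) : HasLinearResolution (Ideal.span {p} * I) (d + e) := by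
  obtain ⟨b, ε, δ, h⟩ := h.exists_isLinearResolution
  refine IsLinearResolution.hasLinearResolution (ι := fun i => Fin (b i)) (ε := p • ε) (δ := δ)
    ⟨fun a v hv => ?_, h.linear, ?_, fun v => ?_, h.exact_succ⟩
  · rw [LinearMap.smul_apply, smul_eq_mul, add_left_comm]
    exact hp.mul (h.augmentation a v hv)
  · ext q
    rw [Ideal.mem_span_singleton_mul, ← h.range_eq]
    constructor
    · rintro ⟨v, rfl⟩
      exact ⟨ε v, ⟨v, rfl⟩, rfl⟩
    · rintro ⟨_, ⟨v, rfl⟩, rfl⟩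
      exact ⟨v, rfl⟩
  · rw [LinearMap.smul_apply, smul_eq_mul, mul_eq_zero, or_iff_right hp0, h.exact_zero]

theorem hasLinearResolution_span_singleton {p : MvPolynomial (Fin n) k} (hp0 : p ≠ 0) {d : ℕ}
    (hp : p.IsHomogeneous d) : HasLinearResolution (Ideal.span {p}) d := by
  simpa using hasLinearResolution_top.span_singleton_mul hp0 hp

/-- Add one variable at a time, using `(x_j) ∩ (T) = x_j (T)` for `j ∉ T`; the iterated cones play
the role of the Koszul complex. -/
theorem hasLinearResolution_span_X (T : Finset (Fin n)) :
    HasLinearResolution (Ideal.span ((X : Fin n → MvPolynomial (Fin n) k) '' T)) 1 := by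
  induction T using Finset.induction_on with
  | empty => simpa using hasLinearResolution_bot 1
  | insert j T hj ih =>
    rw [Finset.coe_insert, Set.image_insert_eq, Ideal.span_insert, ← Submodule.add_eq_sup]
    refine hasLinearResolution_add
      (hasLinearResolution_span_singleton (X_ne_zero j) (isHomogeneous_X k j)) ih ?_
    convert ih.span_singleton_mul (X_ne_zero j) (isHomogeneous_X k j) using 1
    refine le_antisymm ?_ Ideal.mul_le_inf
    rintro p ⟨hp, hpT⟩
    obtain ⟨q, rfl⟩ := Ideal.mem_span_singleton.1 hp
    refine Ideal.mul_mem_mul (Ideal.mem_span_singleton_self _) (mem_ideal_span_X_image.2 ?_)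
    intro a ha
    obtain ⟨i, hi, hai⟩ := mem_ideal_span_X_image.1 hpT (Finsupp.single j 1 + a)
      (by rw [mem_support_iff, coeff_X_mul]; exact mem_support_iff.1 ha)
    refine ⟨i, hi, ?_⟩
    have hij : j ≠ i := fun h => hj (h ▸ hi)
    simpa [Finsupp.single_apply, hij] using hai

theorem mem_monomialIdeal {A : Set (Fin n →₀ ℕ)} {p : MvPolynomial (Fin n) k} :
    p ∈ monomialIdeal k A ↔ ∀ a ∈ p.support, ∃ v ∈ A, v ≤ a :=
  mem_ideal_span_monomial_image

theorem monomial_mem_monomialIdeal {A : Set (Fin n →₀ ℕ)} {a v : Fin n →₀ ℕ} (hv : v ∈ A)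
    (h : v ≤ a) (c : k) : monomial a c ∈ monomialIdeal k A :=
  mem_monomialIdeal.2 fun b hb => by
    classical
    rw [Finset.mem_singleton.1 (support_monomial_subset hb)]
    exact ⟨v, hv, h⟩

/-- A monomial ideal generated in degree `d` with linear quotients has a `d`-linear resolution. -/
theorem hasLinearResolution_of_linearQuotients {α : Type*} [LinearOrder α]
    (f : α → Fin n →₀ ℕ) {d : ℕ} (A : Finset α) (hd : ∀ a ∈ A, (f a).degree = d)
    (h : ∀ u ∈ A, ∀ v ∈ A, v < u →
      ∃ j, f u j < f v j ∧ ∃ v' ∈ A, v' < u ∧ f v' ≤ f u + Finsupp.single j 1) :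
    HasLinearResolution (monomialIdeal k (f '' A)) d := by
  classical
  induction A using Finset.induction_on_max with
  | empty => simpa [monomialIdeal] using hasLinearResolution_bot d
  | insert u A hu ih =>
    have ih := ih (fun a ha => hd a (Finset.mem_insert_of_mem ha)) fun a ha v hv hva => by
      obtain ⟨j, hj, v', hv', hlt, hle⟩ :=
        h a (Finset.mem_insert_of_mem ha) v (Finset.mem_insert_of_mem hv) hva
      refine ⟨j, hj, v', (Finset.mem_insert.1 hv').resolve_left ?_, hlt, hle⟩
      rintro rfl
      exact (hu a ha).not_gt hlt
    have hmon : (monomial (f u) (1 : k)).IsHomogeneous d :=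
      isHomogeneous_monomial _ (hd u (Finset.mem_insert_self _ _))
    have hne : monomial (f u) (1 : k) ≠ 0 := by simp
    have hsum : monomialIdeal k (f '' ↑(insert u A)) =
        monomialIdeal k (f '' A) + Ideal.span {monomial (f u) (1 : k)} := by
      rw [monomialIdeal, Finset.coe_insert, Set.image_insert_eq, Set.image_insert_eq,
        Ideal.span_insert, Submodule.add_eq_sup, sup_comm]
      rfl
    rw [hsum]
    refine hasLinearResolution_add ih (hasLinearResolution_span_singleton hne hmon) ?_
    -- The variables in the colon ideal of the earlier generators by `f u`. The hypothesis says that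
    -- they generate it, so the intersection is `f u` times an ideal of variables.
    let T : Finset (Fin n) := Finset.univ.filter fun j => ∃ v ∈ A, f v ≤ f u + Finsupp.single j 1
    convert (hasLinearResolution_span_X (k := k) T).span_singleton_mul hne hmon using 1
    refine le_antisymm ?_ (le_inf ?_ Ideal.mul_le_left)
    · rintro p ⟨hpA, hp⟩
      obtain ⟨q, rfl⟩ := Ideal.mem_span_singleton.1 hp
      refine Ideal.mul_mem_mul (Ideal.mem_span_singleton_self _) (mem_ideal_span_X_image.2 ?_)
      intro a ha
      obtain ⟨_, ⟨v, hv, rfl⟩, hva⟩ := mem_monomialIdeal.1 hpA (f u + a)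
        (by rw [mem_support_iff, coeff_monomial_mul, one_mul]; exact mem_support_iff.1 ha)
      obtain ⟨j, hj, v', hv', hlt, hle⟩ := h u (Finset.mem_insert_self _ _) v
        (Finset.mem_insert_of_mem hv) (hu v hv)
      refine ⟨j, ?_, ?_⟩
      · exact Finset.mem_filter.2 ⟨Finset.mem_univ _, v',
          (Finset.mem_insert.1 hv').resolve_left hlt.ne, hle⟩
      · have := hva j
        rw [Finsupp.add_apply] at this
        omega
    · rw [Ideal.span_mul_span, Ideal.span_le]
      simp only [Set.singleton_mul, Set.image_subset_iff]
      intro j hj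
      obtain ⟨v, hv, hle⟩ := (Finset.mem_filter.1 hj).2
      simp only [Set.mem_preimage, SetLike.mem_coe, X, monomial_mul]
      exact monomial_mem_monomialIdeal (Set.mem_image_of_mem f hv) hle _

end LinearQuotients

/-! ### Lexicographic order and exchange of variables -/

section Monomials

variable {n d : ℕ}

theorem lex_lt_of_forall_le {u v : Fin n →₀ ℕ} {i : Fin n} (h : ∀ j < i, u j ≤ v j)
    (hi : u i < v i) : toLex u < toLex v := by
  refine lt_of_not_ge fun hle => ?_
  rcases hle.eq_or_lt with heq | hlt
  · rw [toLex_inj.1 heq] at hi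
    exact hi.false
  · obtain ⟨r, hr, hr'⟩ := Finsupp.Lex.lt_iff.1 hlt
    simp only [ofLex_toLex] at hr hr'
    rcases lt_trichotomy r i with hri | rfl | hri
    · exact (h r hri).not_gt hr'
    · exact hi.not_gt hr'
    · exact hi.ne' (hr i hri)

theorem degree_lt_of_le {u v : Fin n →₀ ℕ} (h : ∀ j, u j ≤ v j) {i : Fin n} (hi : u i < v i) :
    u.degree < v.degree := by
  rw [Finsupp.degree_eq_sum, Finsupp.degree_eq_sum]
  exact Finset.sum_lt_sum (fun j _ => h j) ⟨i, Finset.mem_univ i, hi⟩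

theorem eq_of_le_of_degree_eq {u v : Fin n →₀ ℕ} (h : u ≤ v) (hd : u.degree = v.degree) :
    u = v := by
  ext i
  exact (h i).eq_of_not_lt fun hi => (degree_lt_of_le h hi).ne hd

theorem degree_tsub_single {u : Fin n →₀ ℕ} (hd : u.degree = d + 1) {i : Fin n} (hi : u i ≠ 0) :
    (u - Finsupp.single i 1).degree = d := by
  have h : u - Finsupp.single i 1 + Finsupp.single i 1 = u :=
    tsub_add_cancel_of_le (Finsupp.single_le_iff.2 (Nat.one_le_iff_ne_zero.2 hi))
  have h' := congrArg Finsupp.degree h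
  rw [map_add, Finsupp.degree_single, hd] at h'
  omega

theorem exists_gt_of_degree_eq {u v : Fin n →₀ ℕ} (hd : u.degree = v.degree) {i : Fin n}
    (h : ∀ j < i, v j = u j) (hi : v i < u i) : ∃ j, i < j ∧ u j < v j := by
  by_contra! hcon
  refine (degree_lt_of_le (fun j => ?_) hi).ne' hd
  rcases lt_trichotomy j i with hj | rfl | hj
  · exact (h j hj).le
  · exact hi.le
  · exact hcon j hj

/-- The monomial obtained from `u` by replacing the variable `b` by the variable `a`. -/
noncomputable def exchange (u : Fin n →₀ ℕ) (a b : Fin n) : Fin n →₀ ℕ :=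
  u + Finsupp.single a 1 - Finsupp.single b 1

theorem exchange_apply (u : Fin n →₀ ℕ) (a b j : Fin n) :
    exchange u a b j = u j + (if a = j then 1 else 0) - if b = j then 1 else 0 := by
  simp [exchange, Finsupp.single_apply]

theorem exchange_le (u : Fin n →₀ ℕ) (a b : Fin n) : exchange u a b ≤ u + Finsupp.single a 1 :=
  tsub_le_self

theorem exchange_mem_sqfreeMon {u : Fin n →₀ ℕ} (hu : u ∈ sqfreeMon n d) {a b : Fin n}
    (ha : u a = 0) (hb : u b ≠ 0) : exchange u a b ∈ sqfreeMon n d := by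
  refine ⟨fun j => ?_, degree_tsub_single ?_ ?_⟩
  · have := hu.1 j
    rw [exchange_apply]
    split_ifs with h1 h2 h2
    · omega
    · subst h1; omega
    · omega
    · omega
  · rw [map_add, Finsupp.degree_single, hu.2]
  · rw [Finsupp.add_apply]
    omega

theorem lt_exchange {u : Fin n →₀ ℕ} {a b : Fin n} (hab : a < b) :
    toLex u < toLex (exchange u a b) := by
  refine lex_lt_of_forall_le (i := a) (fun j hj => ?_) ?_
  · rw [exchange_apply, if_neg hj.ne', if_neg (hj.trans hab).ne']
    exact le_rfl
  · rw [exchange_apply, if_pos rfl, if_neg hab.ne']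
    omega

theorem exchange_lt {u : Fin n →₀ ℕ} {a b : Fin n} (hab : b < a) (hb : u b ≠ 0) :
    toLex (exchange u a b) < toLex u := by
  refine lex_lt_of_forall_le (i := b) (fun j hj => ?_) ?_
  · rw [exchange_apply, if_neg hj.ne', if_neg (hj.trans hab).ne']
    exact le_rfl
  · rw [exchange_apply, if_pos rfl, if_neg hab.ne']
    omega

theorem finite_sqfreeMon (n d : ℕ) : (sqfreeMon n d).Finite :=
  (Set.finite_Iic (Finsupp.equivFunOnFinite.symm fun _ : Fin n => 1)).subset
    fun _ ha i => ha.1 i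

theorem apply_zero_of_lex_le [NeZero n] {u v : Fin n →₀ ℕ} (h : toLex u ≤ toLex v) :
    u 0 ≤ v 0 := by
  by_contra! hlt
  exact h.not_gt (lex_lt_of_forall_le (fun j hj => absurd hj (Fin.zero_le j).not_gt) hlt)

end Monomials

/-! ### Lexsegments: linear quotients and the intersection in degree `d + 1` -/

section Segments

variable {k : Type*} [Field k] {n d : ℕ}

/-- List generators in decreasing order. If `v > u` first differ at `i`, equal degrees give `j > i`
in the support of `u`, and `x_i u / x_j` is a larger squarefree monomial, so it stays in the
segment. -/
theorem hasLinearResolution_initialSegment (w : Fin n →₀ ℕ) :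
    HasLinearResolution (monomialIdeal k (initialSegment d w)) d := by
  have hfin : (initialSegment d w).Finite := (finite_sqfreeMon n d).subset fun a ha => ha.1
  let e : (Fin n →₀ ℕ) ≃ (Lex (Fin n →₀ ℕ))ᵒᵈ := toLex.trans OrderDual.toDual
  have key := hasLinearResolution_of_linearQuotients (k := k) (d := d) e.symm
    (hfin.toFinset.map e.toEmbedding) (by
      intro a ha
      obtain ⟨u, hu, rfl⟩ := Finset.mem_map.1 ha
      exact ((hfin.mem_toFinset).1 hu).1.2) (by
      intro a ha b hb hlt
      obtain ⟨u, hu, rfl⟩ := Finset.mem_map.1 ha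
      obtain ⟨v, hv, rfl⟩ := Finset.mem_map.1 hb
      rw [hfin.mem_toFinset] at hu hv
      replace hlt : toLex u < toLex v := hlt
      obtain ⟨i, hi, hi'⟩ := Finsupp.Lex.lt_iff.1 hlt
      simp only [ofLex_toLex] at hi hi'
      obtain ⟨j, hij, hj⟩ := exists_gt_of_degree_eq (hv.1.2.trans hu.1.2.symm) hi hi'
      have hvi := hv.1.1 i
      have hlt' : toLex u < toLex (exchange u i j) := lt_exchange hij
      refine ⟨i, hi', e (exchange u i j), ?_, hlt', exchange_le u i j⟩
      exact Finset.mem_map_of_mem _ (hfin.mem_toFinset.2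
        ⟨exchange_mem_sqfreeMon hu.1 (by omega) (by omega), hu.2.trans hlt'.le⟩))
  convert key using 2
  simp [Set.image_image]

/-- The mirror image: increasing order, and the exchange now replaces the first differing variable
by a later one, which makes `u` smaller. -/
theorem hasLinearResolution_finalSegment (m : Fin n →₀ ℕ) :
    HasLinearResolution (monomialIdeal k (finalSegment d m)) d := by
  have hfin : (finalSegment d m).Finite := (finite_sqfreeMon n d).subset fun a ha => ha.1
  let e : (Fin n →₀ ℕ) ≃ Lex (Fin n →₀ ℕ) := toLex
  have key := hasLinearResolution_of_linearQuotients (k := k) (d := d) e.symm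
    (hfin.toFinset.map e.toEmbedding) (by
      intro a ha
      obtain ⟨u, hu, rfl⟩ := Finset.mem_map.1 ha
      exact ((hfin.mem_toFinset).1 hu).1.2) (by
      intro a ha b hb hlt
      obtain ⟨u, hu, rfl⟩ := Finset.mem_map.1 ha
      obtain ⟨v, hv, rfl⟩ := Finset.mem_map.1 hb
      rw [hfin.mem_toFinset] at hu hv
      replace hlt : toLex v < toLex u := hlt
      obtain ⟨i, hi, hi'⟩ := Finsupp.Lex.lt_iff.1 hlt
      simp only [ofLex_toLex] at hi hi'
      obtain ⟨j, hij, hj⟩ := exists_gt_of_degree_eq (hu.1.2.trans hv.1.2.symm) hi hi'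
      have hvj := hv.1.1 j
      have hlt' : toLex (exchange u j i) < toLex u := exchange_lt hij (by omega)
      refine ⟨j, hj, e (exchange u j i), ?_, hlt', exchange_le u j i⟩
      exact Finset.mem_map_of_mem _ (hfin.mem_toFinset.2
        ⟨exchange_mem_sqfreeMon hu.1 (by omega) (by omega), hlt'.le.trans hu.2⟩))
  convert key using 2
  simp [Set.image_image]

variable [NeZero n] {w m : Fin n →₀ ℕ}

theorem exists_isGreatest_notMem_support (hw : w ∈ sqfreeMon n d) (hm : m ∈ sqfreeMon n d)
    (hm1 : (0 : Fin n) ∉ m.support) :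
    ∃ M : Fin n, IsGreatest {i : Fin n | i ∉ w.support} M := by
  have hne : (Finset.univ.filter fun i => i ∉ w.support).Nonempty := by
    by_contra hcon
    have hall : ∀ i, w i ≠ 0 := by simpa [Finset.not_nonempty_iff_eq_empty,
      Finset.filter_eq_empty_iff] using hcon
    rw [Finsupp.notMem_support_iff] at hm1
    -- If `w` had full support, `m` would divide it properly, as it misses `x_1`.
    refine (degree_lt_of_le (u := m) (v := w) (i := 0) (fun i => ?_) ?_).ne (hm.2.trans hw.2.symm)
    · have := hm.1 i
      have := hall i
      omega
    · have := hall 0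
      omega
  refine ⟨Finset.max' _ hne, ?_⟩
  have h := Finset.isGreatest_max' _ hne
  rwa [Finset.coe_filter_univ] at h

/-- The divisor `v` forces `x_1` into `a` while `v'` lacks it, so `a = x_1 v'` by degree;
squarefreeness and the upper bound follow. -/
theorem mem_lexSegment_of_le (hw1 : (0 : Fin n) ∈ w.support) (hm1 : (0 : Fin n) ∉ m.support)
    (hw : w ∈ sqfreeMon n d)
    {M : Fin n} (hM : IsGreatest {i : Fin n | i ∉ w.support} M) {a v v' : Fin n →₀ ℕ}
    (ha : a.degree = d + 1) (hv : v ∈ initialSegment d w) (hva : v ≤ a)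
    (hv' : v' ∈ finalSegment d m) (hva' : v' ≤ a) :
    a ∈ lexSegment (d + 1) (Finsupp.single 0 1 + m) (w + Finsupp.single M 1) := by
  rw [Finsupp.notMem_support_iff] at hm1
  rw [Finsupp.mem_support_iff] at hw1
  have h0 : v' 0 = 0 := Nat.le_zero.1 ((apply_zero_of_lex_le hv'.2).trans hm1.le)
  have h1 : 1 ≤ a 0 := (Nat.one_le_iff_ne_zero.2 hw1).trans
    ((apply_zero_of_lex_le hv.2).trans (hva 0))
  have hav : Finsupp.single 0 1 + v' = a := by
    refine eq_of_le_of_degree_eq (fun i => ?_) ?_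
    · by_cases hi : i = 0
      · subst hi; simpa [h0] using h1
      · simpa [Finsupp.single_apply, Ne.symm hi] using hva' i
    · rw [map_add, Finsupp.degree_single, hv'.1.2, ha, add_comm]
  have hsq : ∀ i, a i ≤ 1 := by
    intro i
    rw [← hav]
    by_cases hi : i = 0
    · subst hi; simp [h0]
    · simpa [Finsupp.single_apply, Ne.symm hi] using hv'.1.1 i
  refine ⟨⟨hsq, ha⟩, ?_, ?_⟩
  · rw [← hav, toLex_add, toLex_add]
    exact add_le_add_right hv'.2 _
  -- Let `s` be the first place where `a` falls below `w x_M`. If `s < M`, then `v < w`. Otherwise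
  -- `a` divides `w x_M` properly, since `w` contains every variable after `x_M`, against equality
  -- of degrees.
  · by_contra! hlt
    obtain ⟨s, hs, hs'⟩ := Finsupp.Lex.lt_iff.1 hlt
    simp only [ofLex_toLex] at hs hs'
    by_cases hsM : s < M
    · refine hv.2.not_gt (lex_lt_of_forall_le (i := s) (fun j hj => ?_) ?_)
      · have := hs j hj
        rw [Finsupp.add_apply, Finsupp.single_eq_of_ne (hj.trans hsM).ne] at this
        exact (hva j).trans this.le
      · rw [Finsupp.add_apply, Finsupp.single_eq_of_ne hsM.ne] at hs'
        exact (hva s).trans_lt hs'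
    · refine (degree_lt_of_le (fun j => ?_) hs').ne ?_
      · rcases lt_or_ge j s with hj | hj
        · exact (hs j hj).le
        · refine (hsq j).trans ?_
          rcases (le_of_not_gt hsM |>.trans hj).eq_or_lt with rfl | hMj
          · simp
          · have : w j ≠ 0 := fun h => hMj.not_ge (hM.2 (Finsupp.notMem_support_iff.2 h))
            rw [Finsupp.add_apply]
            omega
      · rw [ha, map_add, Finsupp.degree_single, hw.2]

/-- Both divisors arise by deleting one variable. For the final segment it is `x_1`; for the initial
one it is a variable after the first difference with `w x_M`, if there is one, and otherwise `w`
itself divides `a`. -/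
theorem exists_le_of_mem_lexSegment (hw1 : (0 : Fin n) ∈ w.support) (hw : w ∈ sqfreeMon n d)
    {M : Fin n} (hM : IsGreatest {i : Fin n | i ∉ w.support} M) {a : Fin n →₀ ℕ}
    (ha : a ∈ lexSegment (d + 1) (Finsupp.single 0 1 + m) (w + Finsupp.single M 1)) :
    (∃ v ∈ initialSegment d w, v ≤ a) ∧ ∃ v ∈ finalSegment d m, v ≤ a := by
  obtain ⟨⟨hsq, hdeg⟩, hle, hge⟩ := ha
  have hsub : ∀ i, a i ≠ 0 → a - Finsupp.single i 1 ∈ sqfreeMon n d := fun i hi =>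
    ⟨fun j => (tsub_le_self (a := a j)).trans (hsq j), degree_tsub_single hdeg hi⟩
  rw [Finsupp.mem_support_iff] at hw1
  constructor
  · rcases hge.eq_or_lt with heq | hlt
    · exact ⟨w, ⟨hw, le_rfl⟩, toLex_inj.1 heq ▸ le_self_add⟩
    obtain ⟨s, hs, hs'⟩ := Finsupp.Lex.lt_iff.1 hlt
    simp only [ofLex_toLex] at hs hs'
    have has := hsq s
    have hws : w s = 0 := by
      rw [Finsupp.add_apply] at hs'
      omega
    have hsM : s < M := by
      refine lt_of_le_of_ne (hM.2 (Finsupp.notMem_support_iff.2 hws)) ?_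
      rintro rfl
      rw [Finsupp.add_apply, Finsupp.single_eq_same] at hs'
      omega
    have hlow : ∀ j < s, w j = a j := fun j hj => by
      have := hs j hj
      rwa [Finsupp.add_apply, Finsupp.single_eq_of_ne (hj.trans hsM).ne] at this
    by_cases ht : ∃ t, s < t ∧ a t ≠ 0
    · obtain ⟨t, hst, hat⟩ := ht
      refine ⟨a - Finsupp.single t 1, ⟨hsub t hat, ?_⟩, tsub_le_self⟩
      refine (lex_lt_of_forall_le (i := s) (fun j hj => ?_) ?_).le
      · rw [Finsupp.tsub_apply, Finsupp.single_eq_of_ne (hj.trans hst).ne]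
        exact (hlow j hj).le
      · rw [Finsupp.tsub_apply, Finsupp.single_eq_of_ne hst.ne]
        omega
    · push Not at ht
      have hsub' := hsub s (by omega)
      -- With nothing in `a` after `x_s`, the quotient `a / x_s` divides `w` and has the same
      -- degree.
      have : a - Finsupp.single s 1 = w := by
        refine eq_of_le_of_degree_eq (fun j => ?_) (hsub'.2.trans hw.2.symm)
        rw [Finsupp.tsub_apply]
        rcases lt_trichotomy j s with hj | rfl | hj
        · exact tsub_le_self.trans (hlow j hj).ge
        · rw [Finsupp.single_eq_same]
          omega
        · rw [ht j hj]
          omega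
      exact ⟨w, ⟨hw, le_rfl⟩, this ▸ tsub_le_self⟩
  · have h0 : a 0 ≠ 0 := by
      have := apply_zero_of_lex_le hge
      rw [Finsupp.add_apply] at this
      omega
    refine ⟨a - Finsupp.single 0 1, ⟨hsub 0 h0, ?_⟩, tsub_le_self⟩
    have h : Finsupp.single 0 1 + (a - Finsupp.single 0 1) = a :=
      add_tsub_cancel_of_le (Finsupp.single_le_iff.2 (Nat.one_le_iff_ne_zero.2 h0))
    rw [← h, toLex_add, toLex_add] at hle
    exact le_of_add_le_add_left hle

end Segments

end SquarefreeLex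

/-! ### The theorem -/

open SquarefreeLex MvPolynomial

theorem mainTheorem9 {k : Type*} [Field k] {n : ℕ} [NeZero n] {d : ℕ} (w m : Fin n →₀ ℕ)
    (hw : w ∈ SquarefreeLex.sqfreeMon n d) (hm : m ∈ SquarefreeLex.sqfreeMon n d)
    (hw1 : (0 : Fin n) ∈ w.support) (hm1 : (0 : Fin n) ∉ m.support)
    (J K : Ideal (MvPolynomial (Fin n) k))
    (hJ : J = SquarefreeLex.monomialIdeal k (SquarefreeLex.initialSegment d w))
    (hK : K = SquarefreeLex.monomialIdeal k (SquarefreeLex.finalSegment d m)) :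
    (SquarefreeLex.HasLinearResolution (J + K) d ↔
      SquarefreeLex.HasLinearResolution (J ⊓ K) (d + 1)) ∧
    ∃ M : Fin n, IsGreatest {i : Fin n | i ∉ w.support} M ∧
      (SquarefreeLex.GeneratedInDegree (J ⊓ K) (d + 1) ↔
        J ⊓ K = SquarefreeLex.monomialIdeal k
          (SquarefreeLex.lexSegment (d + 1)
            (Finsupp.single 0 1 + m) (w + Finsupp.single M 1))) := by
  have hJr : HasLinearResolution J d := hJ ▸ hasLinearResolution_initialSegment w
  have hKr : HasLinearResolution K d := hK ▸ hasLinearResolution_finalSegment m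
  have hmem : ∀ p ∈ J ⊓ K, ∀ a ∈ p.support,
      (∃ v ∈ initialSegment d w, v ≤ a) ∧ ∃ v ∈ finalSegment d m, v ≤ a := by
    rintro p ⟨hp, hp'⟩ a ha
    rw [hJ] at hp
    rw [hK] at hp'
    exact ⟨mem_monomialIdeal.1 hp a ha, mem_monomialIdeal.1 hp' a ha⟩
  refine ⟨⟨fun h => hasLinearResolution_inf hJr hKr h ?_, hasLinearResolution_add hJr hKr⟩, ?_⟩
  · intro p hp hpd
    rw [← support_eq_empty, Finset.eq_empty_iff_forall_notMem]
    intro a ha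
    obtain ⟨⟨v, hv, hva⟩, v', hv', hva'⟩ := hmem p hp a ha
    have had : a.degree = d := by
      by_contra hne
      exact mem_support_iff.1 ha (hpd.coeff_eq_zero hne)
    have h1 := eq_of_le_of_degree_eq hva (hv.1.2.trans had.symm)
    have h2 := eq_of_le_of_degree_eq hva' (hv'.1.2.trans had.symm)
    -- In degree `d` both divisors equal `a`, so `x_1` would have to divide `m`.
    have hwm := (apply_zero_of_lex_le hv.2).trans
      ((h1.trans h2.symm) ▸ apply_zero_of_lex_le hv'.2)
    rw [Finsupp.notMem_support_iff.1 hm1] at hwm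
    exact Finsupp.mem_support_iff.1 hw1 (Nat.le_zero.1 hwm)
  · obtain ⟨M, hM⟩ := exists_isGreatest_notMem_support hw hm hm1
    refine ⟨M, hM, ?_, fun h => ⟨_, ?_, h.symm⟩⟩
    · rintro ⟨G, hG, hGs⟩
      refine le_antisymm ?_ ?_
      · rw [← hGs, Ideal.span_le]
        intro p hp
        refine mem_monomialIdeal.2 fun a ha => ⟨a, ?_, le_rfl⟩
        obtain ⟨⟨v, hv, hva⟩, v', hv', hva'⟩ := hmem p (hGs ▸ Ideal.subset_span hp) a ha
        refine mem_lexSegment_of_le hw1 hm1 hw hM ?_ hv hva hv' hva'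
        by_contra hne
        exact mem_support_iff.1 ha ((hG p hp).coeff_eq_zero hne)
      · rw [monomialIdeal, Ideal.span_le]
        rintro _ ⟨a, ha, rfl⟩
        obtain ⟨⟨v, hv, hva⟩, v', hv', hva'⟩ := exists_le_of_mem_lexSegment hw1 hw hM ha
        exact ⟨hJ ▸ monomial_mem_monomialIdeal hv hva 1,
          hK ▸ monomial_mem_monomialIdeal hv' hva' 1⟩
    · rintro _ ⟨a, ha, rfl⟩
      exact isHomogeneous_monomial _ ha.1.2
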